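/- For a finite-dimensional space $W$ of meromorphic functions on $\mathbb C$, $\dim W=d$, the exponents of $W$ at $z\in\mathbb C$ are the $d$ integers that occur as orders at $z$ of nonzero elements of $W$; $z$ is a singular point of $W$ if they differ from $0,\dots,d-1$. Let $\bar D_W$ be the unique monic linear differential operator of order $d$ with meromorphic coefficients annihilating $W$. If $W$ has finitely many singular points, let $R_W(x)=\prod_{z}(x-z)^{k_z}$, the product being over the singular points $z$ of $W$ and $k_z$ being the smallest natural number such that the coefficients of $(x-z)^{k_z}\bar D_W$ have no pole at $z$. The regularized fundamental operator of $W$ is $D_W=R_W\bar D_W$. The conjugate space $W^\star$ is spanned by the functions $\mathrm{Wr}(f_1,\dots,f_{d-1})/\mathrm{Wr}_W$, $f_i\in W$, where $\mathrm{Wr}$ denotes the Wronskian and $\mathrm{Wr}_W$ is the Wronskian of a basis of $W$; the regularized conjugate space is $W^\dagger=\{f/R_W : f\in W^\star\}$. Let $\lambda_1,\dots,\lambda_n$ be distinct complex numbers, let $N_1,\dots,N_n$ be positive integers, $N=N_1+\dots+N_n$, and for $1\le i\le n$ let $0<n_{i1}<\dots<n_{iN_i}$ be integers and $p_{ij}\in\mathbb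 C[x]$ polynomials of degree $n_{ij}$. Let $V$ be the complex vector space spanned by the functions $p_{ij}(x)e^{\lambda_i x}$, $1\le i\le n$, $1\le j\le N_i$. Let $z_1,\dots,z_m$ be the distinct singular points of $V$, and let $$\{0<\dots<N-M_a-1<N-M_a+m_{a1}<\dots<N-M_a+m_{aM_a}\}$$ be the set of exponents of $V$ at $z_a$, where $1\le M_a\le N$ and $0<m_{a1}<\dots<m_{aM_a}$. Put $M=M_1+\dots+M_m$. For each $a$ let $\gamma_a$ be a counterclockwise circle centred at $z_a$ such that no other singular point of $V$ lies on or inside it, and let $U$ (the bispectral dual of $V$) be the complex vector space spanned by the functions $$\hat f_a(u)=\oint_{\gamma_a}e^{ux}f(x)\,dx,\qquad 1\le a\le m,\quad f\in V^\dagger .$$ Then: (i) $\dim U=M$. (ii) For $1\le a\le m$ and $1\le b\le M_a$, the space $U$ contains a function of the form $q_{ab}(u)e^{z_au}$, where $q_{ab}$ is a polynomial of degree $m_{ab}$. (iii) The regularized fundamental operator of $V$ has the form $D_V=\sum_{i=0}^M\sum_{j=0}^N A_{ij}x^i\partial_x^j$ with $A_{ij}\in\mathbb C$, and $\sum_{i=0}^M\sum_{j=0}^N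 A_{ij}u^j\partial_u^i$ is the regularized fundamental operator of $U$. (iv) The set of singular points of $U$ in $\mathbb C$ is $\{\lambda_1,\dots,\lambda_n\}$. (v) For $1\le i\le n$, the set of exponents of $U$ at $\lambda_i$ is $$\{0<\dots<M-N_i-1<M-N_i+n_{i1}<M-N_i+n_{i2}<\dots<M-N_i+n_{iN_i}\}.$$ -/

import Mathlib

open Filter

noncomputable section

/-- The Wronskian of `f 0, …, f (k - 1)`: the determinant of the matrix whose `j`-th row is
`f j, (f j)', …, (f j)^(k-1)`.  For `k = 0` it is the constant function `1`. -/
def Wronskian {k : ℕ} (f : Fin k → ℂ → ℂ) (x : ℂ) : ℂ :=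
  (Matrix.of fun j l : Fin k => iteratedDeriv (l : ℕ) (f j) x).det

/-- The set of exponents at `z` of a space `W` of meromorphic functions: the orders at `z` of the
elements of `W` (the zero function, of order `⊤`, does not contribute). -/
def exponents (W : Submodule ℂ (ℂ → ℂ)) (z : ℂ) : Set ℤ :=
  {e | ∃ f ∈ W, meromorphicOrderAt f z = (e : WithTop ℤ)}

/-- `z` is singular if the exponents at `z` are not `0, …, dim W - 1`. -/
def singularPoints (W : Submodule ℂ (ℂ → ℂ)) : Set ℂ :=
  {z | exponents W z ≠ Set.Ico (0 : ℤ) (Module.finrank ℂ W)}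

/-- `A 0 + A 1 ∂ + ⋯ + A N ∂ ^ N` is a monic differential operator with meromorphic coefficients,
of order `N = dim W`, which annihilates `W`.  Identities between meromorphic functions are read
off a discrete closed set of points. -/
structure IsMonicFundamentalOperator (N : ℕ) (W : Submodule ℂ (ℂ → ℂ))
    (A : Fin (N + 1) → ℂ → ℂ) : Prop where
  dim : Module.finrank ℂ W = N
  meromorphic : ∀ j z, MeromorphicAt (A j) z
  monic : ∀ x, A (Fin.last N) x = 1
  annihilates : ∀ f ∈ W,
    (fun x => ∑ j : Fin (N + 1), A j x * iteratedDeriv (j : ℕ) f x) =ᶠ[codiscrete ℂ] 0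

/-- The smallest natural number `k` such that no coefficient of `(x - z) ^ k * D` has a pole
at `z`, where `D` is the monic fundamental operator of `W`. -/
def poleOrder (W : Submodule ℂ (ℂ → ℂ)) (z : ℂ) : ℕ :=
  sInf {k : ℕ | ∃ A : Fin (Module.finrank ℂ W + 1) → ℂ → ℂ,
    IsMonicFundamentalOperator (Module.finrank ℂ W) W A ∧
      ∀ j, 0 ≤ meromorphicOrderAt (fun x => (x - z) ^ k * A j x) z}

/-- The polynomial function `∏ (x - z) ^ M_z` over the singular points `z` of `W`. -/
def regularizingFactor (W : Submodule ℂ (ℂ → ℂ)) (x : ℂ) : ℂ :=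
  ∏ᶠ z ∈ singularPoints W, (x - z) ^ poleOrder W z

/-- `D 0 + D 1 ∂ + ⋯ + D N ∂ ^ N` is the regularized fundamental operator of `W`: the monic
fundamental operator multiplied by `∏ (x - z) ^ M_z`.  Its coefficients are entire, that is, their
removable singularities have been removed. -/
def IsRegularizedFundamentalOperator (N : ℕ) (W : Submodule ℂ (ℂ → ℂ))
    (D : Fin (N + 1) → ℂ → ℂ) : Prop :=
  (singularPoints W).Finite ∧
    ∃ A : Fin (N + 1) → ℂ → ℂ, IsMonicFundamentalOperator N W A ∧
      ∀ j, Differentiable ℂ (D j) ∧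
        D j =ᶠ[codiscrete ℂ] fun x => regularizingFactor W x * A j x

/-- The conjugate space, spanned by the functions `Wr(f_1, …, f_{N-1}) / Wr_W` with `f_i ∈ W`,
where `N = dim W` and `Wr_W` is the Wronskian of a basis of `W`.  Another basis changes `Wr_W` by
a nonzero constant factor only, so that letting the basis vary does not change the span. -/
def conjugateSpace (W : Submodule ℂ (ℂ → ℂ)) : Submodule ℂ (ℂ → ℂ) :=
  Submodule.span ℂ {g | ∃ (b : Module.Basis (Fin (Module.finrank ℂ W)) ℂ W)
    (f : Fin (Module.finrank ℂ W - 1) → W),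
      g = fun x => Wronskian (fun i => (f i : ℂ → ℂ)) x / Wronskian (fun i => (b i : ℂ → ℂ)) x}

/-- The regularized conjugate space, spanned by the functions `f * ∏ (x - z) ^ (-M_z)` with `f` in
the conjugate space. -/
def regularizedConjugateSpace (W : Submodule ℂ (ℂ → ℂ)) : Submodule ℂ (ℂ → ℂ) :=
  Submodule.span ℂ {g | ∃ f ∈ conjugateSpace W, g = fun x => f x * (regularizingFactor W x)⁻¹}

/-- The circle of radius `r z` around a singular point `z` is small: it neither meets nor encloses
another singular point. -/
def SmallCircles (W : Submodule ℂ (ℂ → ℂ)) (r : ℂ → ℝ) : Prop :=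
  ∀ z ∈ singularPoints W, 0 < r z ∧
    ∀ w ∈ singularPoints W, w ≠ z → w ∉ Metric.closedBall z (r z)

/-- The bispectral dual, spanned by the functions `u ↦ ∮ exp (u x) f(x) dx` over the circles of
radius `r z` around the singular points `z` of `W`, with `f` in the regularized conjugate space. -/
def bispectralDual (W : Submodule ℂ (ℂ → ℂ)) (r : ℂ → ℝ) : Submodule ℂ (ℂ → ℂ) :=
  Submodule.span ℂ {g | ∃ z ∈ singularPoints W, ∃ f ∈ regularizedConjugateSpace W,
    g = fun u => ∮ x in C(z, r z), Complex.exp (u * x) * f x}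

/-- The span of the functions `p_{ij}(x) exp (λ_i x)`. -/
def quasiPolynomialSpace {n : ℕ} {k : Fin n → ℕ} (p : ∀ i, Fin (k i) → Polynomial ℂ)
    (lam : Fin n → ℂ) : Submodule ℂ (ℂ → ℂ) :=
  Submodule.span ℂ {g | ∃ (i : Fin n) (j : Fin (k i)),
    g = fun x => (p i j).eval x * Complex.exp (lam i * x)}

/-- The set `{0 < ⋯ < N - k - 1 < N - k + e_1 < ⋯ < N - k + e_k}` of integers. -/
def shiftedExponents (N k : ℕ) (e : Fin k → ℕ) : Set ℤ :=
  Set.Ico (0 : ℤ) ((N : ℤ) - k) ∪ Set.range fun b : Fin k => (N : ℤ) - k + e b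

end

/-! Record an operator with polynomial coefficients by the matrix of its coefficients `A i j` of
`x^i ∂^j`; exchanging `x` and `∂` transposes the matrix. Everything is read off one operator `D = ∑
c j ∂^j` that kills `V`, has monic leading coefficient, and whose coefficients have no common zero
(`exists_primitive_operator`).

The lowest part of `D` at a point `z` acts on powers of `x - z`, and the highest part of `D` on
functions `p exp(λx)` acts on leading terms, each through a polynomial in the exponent, written in
falling factorials. Among its roots are the exponents of `V` at `z`, respectively the degrees
`n_ij`. The numerical information comes from counting these roots against the degree
(`eq_zero_of_sum_descFactorial_eq_zero`). At `z_a` the count shows that the leading coefficient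
vanishes to order exactly `M_a` (`rootMultiplicity_last_eq`), so it has degree `M` and `D` is the
regularized operator of `V`. At `λ_i` it shows that `(∂ - λ_i)^N_i` divides the coefficient of the
highest power of `x`. Since `D` has order `N`, this coefficient is the full product, and the highest
power is `x^M` (`dualCoeff_natDegree_last`). The transposed operator therefore has order `M` and
leading coefficient `∏ (u - λ_i)^N_i`.

The transposed operator kills `U`: under the integral sign it becomes `D` acting on `exp(ux)`, and
`D h` times a regularized conjugate function is an exact derivative, by variation of parameters
(`exists_hasDerivAt_variation`). The integrals themselves are residues. In a basis adapted to `z_a`,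
an element of order `s` gives a regularized conjugate function of order `N - 1 - s - M_a`. Its
transform is zero if there is no pole, and otherwise a polynomial of degree `d = s + M_a - N` times
`exp(z_a u)`. Thus `d` runs through the `m_ab`, and `U` is again a space of quasi-polynomials, of
dimension `M`.

Finally, with `k = M - N_i`, the indicial polynomial of the transposed operator at `λ_i` is the
falling factorial of `s` of length `k` times `P(s - k)`, where `P` is the polynomial of `D` at
infinity (`sum_indicialCoeff_dual`). Its natural roots are `0, …, k - 1` and the `k + n_ij`; there
are `M` of them, so they are the exponents of `U`. As no `n_ij` is zero, `P(0) ≠ 0`, which says that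
the coefficient of `∂^k` does not vanish at `λ_i`. Hence the transposed operator is primitive, and
is the regularized operator of `U`. -/

open scoped Topology Polynomial

noncomputable section

/-! ### Entire functions and their orders -/

/-- The space of entire functions. -/
def entireFunctions : Submodule ℂ (ℂ → ℂ) where
  carrier := {f | Differentiable ℂ f}
  add_mem' hf hg := hf.add hg
  zero_mem' := differentiable_const 0
  smul_mem' c _ hf := hf.const_smul c

theorem Differentiable.iteratedDeriv_entire {f : ℂ → ℂ} (hf : Differentiable ℂ f) (l : ℕ) :
    Differentiable ℂ (iteratedDeriv l f) :=
  (hf.contDiff (n := ⊤)).differentiable_iteratedDeriv l (by exact_mod_cast WithTop.coe_lt_top _)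

/-- The value at `x` of the `l`-th derivative, as a linear form on entire functions. -/
def iteratedDerivForm (l : ℕ) (x : ℂ) : entireFunctions →ₗ[ℂ] ℂ where
  toFun f := iteratedDeriv l f x
  map_add' f g := iteratedDeriv_add (f.2.contDiff (n := l)).contDiffAt
    (g.2.contDiff (n := l)).contDiffAt
  map_smul' c f := by
    simp [iteratedDeriv_const_smul (f.2.contDiff (n := l)).contDiffAt c]

theorem iteratedDeriv_sum_entire {ι : Type*} (t : Finset ι) (c : ι → ℂ) (f : ι → ℂ → ℂ)
    (hf : ∀ i, Differentiable ℂ (f i)) (l : ℕ) (x : ℂ) :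
    iteratedDeriv l (∑ i ∈ t, c i • f i) x = ∑ i ∈ t, c i * iteratedDeriv l (f i) x := by
  have h : ∑ i ∈ t, c i • f i =
      ((∑ i ∈ t, c i • (⟨f i, hf i⟩ : entireFunctions) : entireFunctions) : ℂ → ℂ) := by simp
  rw [h]
  change iteratedDerivForm l x _ = _
  rw [map_sum]
  simp only [map_smul]
  rfl

theorem meromorphicOrderAt_eq_iff_iteratedDeriv {f : ℂ → ℂ} (hf : Differentiable ℂ f) (z : ℂ)
    (s : ℕ) : meromorphicOrderAt f z = ((s : ℤ) : WithTop ℤ) ↔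
      (∀ k < s, iteratedDeriv k f z = 0) ∧ iteratedDeriv s f z ≠ 0 := by
  rw [← analyticOrderAt_eq_nat_iff_iteratedDeriv_eq_zero (hf.analyticAt z),
    (hf.analyticAt z).meromorphicOrderAt_eq]
  cases h : analyticOrderAt f z with
  | top => simp
  | coe n =>
    rw [ENat.map_natCast]
    norm_cast

theorem exists_meromorphicOrderAt_eq {f : ℂ → ℂ} (hf : Differentiable ℂ f) (hf0 : f ≠ 0) (z : ℂ) :
    ∃ s : ℕ, meromorphicOrderAt f z = ((s : ℤ) : WithTop ℤ) := by
  have h := (AnalyticOnNhd.analyticOrderAt_eq_top_iff_eq_zero z fun w => hf.analyticAt w).not.2 hf0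
  obtain ⟨s, hs⟩ := ENat.ne_top_iff_exists.1 h
  refine ⟨s, ?_⟩
  rw [(hf.analyticAt z).meromorphicOrderAt_eq, ← hs, ENat.map_natCast]

theorem natCast_of_meromorphicOrderAt_eq {f : ℂ → ℂ} (hf : Differentiable ℂ f) {z : ℂ} {e : ℤ}
    (h : meromorphicOrderAt f z = (e : WithTop ℤ)) : ∃ s : ℕ, e = s := by
  have h0 := (hf.analyticAt z).meromorphicOrderAt_nonneg
  rw [h] at h0
  exact Int.eq_ofNat_of_zero_le (by exact_mod_cast h0)

/-- An entire function of order `s` at `z` is `(x - z) ^ s` times an entire function. -/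
theorem exists_eq_pow_mul_entire {f : ℂ → ℂ} (hf : Differentiable ℂ f) {z : ℂ} {s : ℕ}
    (h : meromorphicOrderAt f z = ((s : ℤ) : WithTop ℤ)) :
    ∃ u : ℂ → ℂ, Differentiable ℂ u ∧ u z ≠ 0 ∧ ∀ x, f x = (x - z) ^ s * u x := by
  have hs : analyticOrderAt f z = s :=
    (analyticOrderAt_eq_nat_iff_iteratedDeriv_eq_zero (hf.analyticAt z)).2
      ((meromorphicOrderAt_eq_iff_iteratedDeriv hf z s).1 h)
  obtain ⟨g, hg, hgz, hfg⟩ := (hf.analyticAt z).analyticOrderAt_eq_natCast.1 hs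
  -- The quotient is differentiable off `z`; its value at `z` is taken from the local analytic
  -- factor, with which it agrees near `z`.
  set u : ℂ → ℂ := Function.update (fun x => f x / (x - z) ^ s) z (g z) with hu
  have huz : u =ᶠ[𝓝 z] g := by
    filter_upwards [hfg] with x hx
    rcases eq_or_ne x z with rfl | hxz
    · simp [hu]
    · have : (x - z) ^ s ≠ 0 := pow_ne_zero _ (sub_ne_zero.2 hxz)
      rw [hu, Function.update_of_ne hxz, hx, smul_eq_mul, mul_div_cancel_left₀ _ this]
  have huf : ∀ x, f x = (x - z) ^ s * u x := by
    intro x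
    rcases eq_or_ne x z with rfl | hxz
    · rw [hfg.self_of_nhds, huz.self_of_nhds, smul_eq_mul]
    · have : (x - z) ^ s ≠ 0 := pow_ne_zero _ (sub_ne_zero.2 hxz)
      rw [hu, Function.update_of_ne hxz, mul_div_cancel₀ _ this]
  refine ⟨u, fun x => ?_, by rwa [huz.self_of_nhds], huf⟩
  rcases eq_or_ne x z with rfl | hxz
  · exact (hg.congr huz.symm).differentiableAt
  · have hev : u =ᶠ[𝓝 x] fun x => f x / (x - z) ^ s := by
      filter_upwards [isOpen_ne.mem_nhds hxz] with y hy
      rw [hu, Function.update_of_ne hy]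
    refine DifferentiableAt.congr_of_eventuallyEq ?_ hev
    exact (hf x).div (by fun_prop) (pow_ne_zero _ (sub_ne_zero.2 hxz))

theorem cast_descFactorial_succ (s j : ℕ) :
    (s.descFactorial (j + 1) : ℂ) = ((s : ℂ) - j) * s.descFactorial j := by
  rcases lt_or_ge s j with h | h
  · simp [Nat.descFactorial_eq_zero_iff_lt.2 h, Nat.descFactorial_succ]
  · rw [Nat.descFactorial_succ]; push_cast [h]; ring

/-- The leading terms at `z` of the derivatives of a function `(x - z) ^ s * u`. -/
theorem exists_iteratedDeriv_eq_zpow_mul {f u : ℂ → ℂ} (hu : Differentiable ℂ u) {z : ℂ} {s : ℕ}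
    (hfu : ∀ x, f x = (x - z) ^ s * u x) (j : ℕ) :
    ∃ v : ℂ → ℂ, Differentiable ℂ v ∧ v z = s.descFactorial j * u z ∧
      ∀ x ≠ z, iteratedDeriv j f x = (x - z) ^ ((s : ℤ) - j) * v x := by
  induction j with
  | zero => exact ⟨u, hu, by simp, fun x _ => by simp [hfu]⟩
  | succ j ih =>
    obtain ⟨v, hv, hvz, hfv⟩ := ih
    have hv' : Differentiable ℂ (deriv v) := by
      simpa [iteratedDeriv_one] using hv.iteratedDeriv_entire 1
    refine ⟨fun x => ((s : ℂ) - j) * v x + (x - z) * deriv v x, by fun_prop, ?_, ?_⟩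
    · dsimp only
      rw [cast_descFactorial_succ, sub_self, zero_mul, add_zero, hvz, mul_assoc]
    · intro x hx
      have hev : iteratedDeriv j f =ᶠ[𝓝 x] fun y => (y - z) ^ ((s : ℤ) - j) * v y := by
        filter_upwards [isOpen_ne.mem_nhds hx] with y hy using hfv y hy
      have hxz : x - z ≠ 0 := sub_ne_zero.2 hx
      have hd : HasDerivAt (fun y => (y - z) ^ ((s : ℤ) - j) * v y)
          ((((s : ℤ) - j : ℤ) : ℂ) * (x - z) ^ ((s : ℤ) - j - 1) * 1 * v x +
            (x - z) ^ ((s : ℤ) - j) * deriv v x) x := by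
        refine HasDerivAt.mul ?_ (hv x).hasDerivAt
        exact (hasDerivAt_zpow ((s : ℤ) - j) (x - z) (Or.inl hxz)).comp x
          ((hasDerivAt_id x).sub_const z)
      rw [iteratedDeriv_succ, hev.deriv_eq, hd.deriv]
      have h1 : (x - z) ^ ((s : ℤ) - j) = (x - z) ^ ((s : ℤ) - j - 1) * (x - z) := by
        rw [← zpow_add_one₀ hxz]; congr 1; ring
      rw [h1, show (s : ℤ) - ((j + 1 : ℕ) : ℤ) = (s : ℤ) - j - 1 by push_cast; ring]
      push_cast
      ring

/-! ### Bases adapted to a point -/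

theorem linearIndependent_of_injective_order {ι : Type*} {f : ι → ℂ → ℂ}
    (hf : ∀ i, Differentiable ℂ (f i)) {z : ℂ} {e : ι → ℕ} (he : Function.Injective e)
    (hord : ∀ i, meromorphicOrderAt (f i) z = ((e i : ℤ) : WithTop ℤ)) :
    LinearIndependent ℂ f := by
  classical
  rw [linearIndependent_iff']
  intro t c hc
  by_contra! hne
  obtain ⟨i₀, hi₀, hc₀⟩ := hne
  obtain ⟨i, hi, hmin⟩ := Finset.exists_min_image (t.filter fun i => c i ≠ 0) e
    ⟨i₀, by simp [hi₀, hc₀]⟩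
  rw [Finset.mem_filter] at hi
  have h := iteratedDeriv_sum_entire t c f hf (e i) z
  rw [hc, Finset.sum_eq_single i] at h
  · have h1 := ((meromorphicOrderAt_eq_iff_iteratedDeriv (hf i) z _).1 (hord i)).2
    have h2 : iteratedDeriv (e i) (0 : ℂ → ℂ) z = 0 := iteratedDeriv_const_zero
    rw [h2] at h
    exact mul_ne_zero hi.2 h1 h.symm
  · intro j hj hji
    by_cases hcj : c j = 0
    · simp [hcj]
    · have hlt : e i < e j := lt_of_le_of_ne (hmin j (by simp [hj, hcj])) fun h => hji (he h.symm)
      rw [((meromorphicOrderAt_eq_iff_iteratedDeriv (hf j) z _).1 (hord j)).1 _ hlt, mul_zero]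
  · exact fun h => absurd hi.1 h

/-- Induction on the dimension: choose an element of least order `s`. The elements whose `s`-th
derivative vanishes at `z` form a hyperplane, and all their orders exceed `s`. -/
theorem exists_injective_order (z : ℂ) (d : ℕ) : ∀ W : Submodule ℂ (ℂ → ℂ),
    W ≤ entireFunctions → FiniteDimensional ℂ W → Module.finrank ℂ W = d →
    ∃ (f : Fin d → ℂ → ℂ) (e : Fin d → ℕ), Function.Injective e ∧ ∀ i, f i ∈ W ∧
      meromorphicOrderAt (f i) z = ((e i : ℤ) : WithTop ℤ) := by
  induction d with
  | zero => exact fun W _ _ _ => ⟨fun i => i.elim0, fun i => i.elim0, fun i => i.elim0,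
      fun i => i.elim0⟩
  | succ d ih =>
    intro W hW hfin hdim
    have hex : ∃ s : ℕ, ∃ f ∈ W, meromorphicOrderAt f z = ((s : ℤ) : WithTop ℤ) := by
      have : Nontrivial W := Module.nontrivial_of_finrank_pos (R := ℂ) (by omega)
      obtain ⟨⟨f, hf⟩, hf0⟩ := exists_ne (0 : W)
      obtain ⟨s, hs⟩ := exists_meromorphicOrderAt_eq (hW hf) (fun h => hf0 (Subtype.ext h)) z
      exact ⟨s, f, hf, hs⟩
    classical
    set s := Nat.find hex with hs
    obtain ⟨f, hf, hfs⟩ := Nat.find_spec hex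
    rw [← hs] at hfs
    set L : W →ₗ[ℂ] ℂ := (iteratedDerivForm s z).comp (Submodule.inclusion hW) with hL
    have hLv : ∀ g : W, L g = iteratedDeriv s g z := fun g => rfl
    have hsurj : LinearMap.range L = ⊤ := by
      refine LinearMap.range_eq_top.2 (LinearMap.surjective fun h => ?_)
      refine ((meromorphicOrderAt_eq_iff_iteratedDeriv (hW hf) z s).1 hfs).2 ?_
      rw [← hLv ⟨f, hf⟩, h]; rfl
    have hker := LinearMap.finrank_range_add_finrank_ker L
    rw [hsurj, finrank_top, Module.finrank_self, hdim] at hker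
    set W' := (LinearMap.ker L).map W.subtype with hW'
    have hdim' : Module.finrank ℂ W' = d := by
      rw [hW', Submodule.finrank_map_subtype_eq]
      omega
    have hle : W' ≤ W := by
      rintro g ⟨g', -, rfl⟩; exact g'.2
    obtain ⟨f', e', he', hfe'⟩ := ih W' (hle.trans hW) inferInstance hdim'
    have hgt : ∀ i, s < e' i := by
      intro i
      have h1 : s ≤ e' i := Nat.find_min' hex ⟨f' i, hle (hfe' i).1, (hfe' i).2⟩
      refine lt_of_le_of_ne h1 fun h2 => ?_
      have h3 := ((meromorphicOrderAt_eq_iff_iteratedDeriv (hW (hle (hfe' i).1)) z _).1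
        (hfe' i).2).2
      obtain ⟨g, hg, hgf⟩ := (hfe' i).1
      rw [← h2, ← hgf] at h3
      exact h3 hg
    refine ⟨Fin.cons f f', Fin.cons s e', ?_, ?_⟩
    · rw [Fin.cons_injective_iff]
      exact ⟨fun ⟨i, hi⟩ => (hgt i).ne hi.symm, he'⟩
    · intro i
      refine Fin.cases ?_ (fun i => ?_) i
      · exact ⟨hf, hfs⟩
      · exact ⟨hle (hfe' i).1, (hfe' i).2⟩

/-- A finite-dimensional space of entire functions has a basis with pairwise distinct orders at
`z`, and these orders are all the exponents at `z`. -/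
theorem exists_adapted_basis {W : Submodule ℂ (ℂ → ℂ)} (hW : W ≤ entireFunctions)
    [FiniteDimensional ℂ W] {d : ℕ} (hd : Module.finrank ℂ W = d) (z : ℂ) :
    ∃ (b : Module.Basis (Fin d) ℂ W) (e : Fin d → ℕ), Function.Injective e ∧
      (∀ i, meromorphicOrderAt (b i : ℂ → ℂ) z = ((e i : ℤ) : WithTop ℤ)) ∧
      exponents W z = Set.range fun i => (e i : ℤ) := by
  obtain ⟨f, e, he, hfe⟩ := exists_injective_order z d W hW inferInstance hd
  have hli : LinearIndependent ℂ (fun i => (⟨f i, (hfe i).1⟩ : W)) := by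
    refine LinearIndependent.of_comp W.subtype ?_
    exact linearIndependent_of_injective_order (fun i => hW (hfe i).1) he fun i => (hfe i).2
  have hcard : Fintype.card (Fin d) = Module.finrank ℂ W := by simp [hd]
  refine ⟨basisOfLinearIndependentOfCardEqFinrank' _ hli hcard, e, he, fun i => ?_, ?_⟩
  · simpa using (hfe i).2
  · ext k
    constructor
    · rintro ⟨g, hg, hgk⟩
      obtain ⟨s, rfl⟩ := natCast_of_meromorphicOrderAt_eq (hW hg) hgk
      by_contra hne
      have hs : ∀ i, e i ≠ s := fun i hi => hne ⟨i, by simp [hi]⟩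
      -- An order outside the list would make `g` independent of the `d` functions already found.
      have hli' : LinearIndependent ℂ (Fin.cons g f : Fin (d + 1) → ℂ → ℂ) := by
        refine linearIndependent_of_injective_order (z := z) (e := Fin.cons s e) ?_ ?_ ?_
        · exact fun i => Fin.cases (hW hg) (fun i => hW (hfe i).1) i
        · rw [Fin.cons_injective_iff]
          exact ⟨fun ⟨i, hi⟩ => hs i hi, he⟩
        · exact fun i => Fin.cases hgk (fun i => (hfe i).2) i
      have hmem : ∀ i, (Fin.cons g f : Fin (d + 1) → ℂ → ℂ) i ∈ W :=
        fun i => Fin.cases hg (fun i => (hfe i).1) i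
      have hli'' : LinearIndependent ℂ (fun i => (⟨_, hmem i⟩ : W)) :=
        LinearIndependent.of_comp W.subtype hli'
      have := hli''.fintype_card_le_finrank
      simp [hd] at this
    · rintro ⟨i, rfl⟩
      exact ⟨f i, (hfe i).1, (hfe i).2⟩

/-! ### Falling factorials -/

/-- A polynomial with more roots than its degree is zero, and falling factorials are linearly
independent. -/
theorem eq_zero_of_sum_descFactorial_eq_zero {N : ℕ} {β : Fin (N + 1) → ℂ} (S : Finset ℕ)
    (hS : ∀ s ∈ S, ∑ j, β j * (s.descFactorial j : ℂ) = 0)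
    (hβ : ∀ j : Fin (N + 1), S.card ≤ j → β j = 0) : β = 0 := by
  classical
  set P : ℂ[X] := ∑ j, Polynomial.C (β j) * descPochhammer ℂ j with hP
  have heval : ∀ s : ℕ, P.eval (s : ℂ) = ∑ j, β j * (s.descFactorial j : ℂ) := by
    intro s
    simp [hP, Polynomial.eval_finsetSum, descPochhammer_eval_eq_descFactorial]
  have hP0 : P = 0 := by
    by_contra hne
    have hdeg : P.degree < S.card := by
      rw [← Polynomial.mem_degreeLT]
      refine Submodule.sum_mem _ fun j _ => ?_
      rcases le_or_gt S.card j with hj | hj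
      · simp [hβ j hj]
      · rw [Polynomial.mem_degreeLT]
        refine lt_of_le_of_lt (Polynomial.degree_le_of_natDegree_le (n := j) ?_)
          (by exact_mod_cast hj)
        exact (Polynomial.natDegree_C_mul_le _ _).trans_eq (descPochhammer_natDegree _ _)
    have hle : S.card ≤ P.natDegree := by
      rw [← Finset.card_image_of_injective S (Nat.cast_injective (R := ℂ))]
      refine Polynomial.card_le_degree_of_subset_roots fun x hx => ?_
      obtain ⟨s, hs, rfl⟩ := Finset.mem_image.1 (show x ∈ S.image _ from hx)
      rw [Polynomial.mem_roots hne, Polynomial.IsRoot, heval, hS s hs]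
    rw [Polynomial.degree_eq_natDegree hne] at hdeg
    exact absurd hle (by exact_mod_cast hdeg.not_ge)
  have hall : ∀ s : ℕ, ∑ j, β j * (s.descFactorial j : ℂ) = 0 := by
    intro s; rw [← heval, hP0, Polynomial.eval_zero]
  -- Evaluation at `n` is triangular: falling factorials longer than `n` vanish there, and the
  -- shorter ones already have coefficient zero.
  have key : ∀ n (hn : n < N + 1), β ⟨n, hn⟩ = 0 := by
    intro n
    induction n using Nat.strong_induction_on with
    | _ n ih =>
      intro hn
      have h := hall n
      rw [Finset.sum_eq_single ⟨n, hn⟩] at h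
      · simpa [Nat.factorial_ne_zero] using h
      · intro j _ hj
        rcases lt_trichotomy (j : ℕ) n with h | h | h
        · rw [show j = ⟨j, j.2⟩ from rfl, ih j h, zero_mul]
        · exact absurd (Fin.ext h) hj
        · rw [Nat.descFactorial_eq_zero_iff_lt.2 h]; simp
      · simp
  funext j
  exact key j j.2

/-! ### Differential operators with polynomial coefficients -/

/-- The operator `∑ c j ∂ ^ j` annihilates `f`. -/
def Annihilates {N : ℕ} (c : Fin (N + 1) → ℂ[X]) (f : ℂ → ℂ) : Prop :=
  ∀ x, ∑ j, (c j).eval x * iteratedDeriv (j : ℕ) f x = 0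

theorem annihilates_of_mem_span {N : ℕ} {c : Fin (N + 1) → ℂ[X]} {s : Set (ℂ → ℂ)}
    (hs : ∀ f ∈ s, Differentiable ℂ f ∧ Annihilates c f) {f : ℂ → ℂ}
    (hf : f ∈ Submodule.span ℂ s) : Differentiable ℂ f ∧ Annihilates c f := by
  induction hf using Submodule.span_induction with
  | mem f hf => exact hs f hf
  | zero =>
    refine ⟨differentiable_const 0, fun x => ?_⟩
    simp [iteratedDeriv_const_zero]
  | add f g _ _ hf hg =>
    refine ⟨hf.1.add hg.1, fun x => ?_⟩
    have h : ∀ j : ℕ, iteratedDeriv j (f + g) x = iteratedDeriv j f x + iteratedDeriv j g x :=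
      fun j => iteratedDeriv_add (hf.1.contDiff (n := j)).contDiffAt
        (hg.1.contDiff (n := j)).contDiffAt
    simp only [h, mul_add, Finset.sum_add_distrib, hf.2 x, hg.2 x, add_zero]
  | smul a f _ hf =>
    refine ⟨hf.1.const_smul a, fun x => ?_⟩
    have h : ∀ j : ℕ, iteratedDeriv j (a • f) x = a * iteratedDeriv j f x :=
      fun j => iteratedDeriv_const_smul (hf.1.contDiff (n := j)).contDiffAt a
    simp only [h, mul_left_comm _ a, ← Finset.mul_sum, hf.2 x, mul_zero]

/-- The coefficients, with respect to falling factorials, of the polynomial which describes the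
action of the terms of degree `h` of the operator `∑ c j ∂ ^ j` on powers of `x - z`. -/
def indicialCoeff {N : ℕ} (z : ℂ) (c : Fin (N + 1) → ℂ[X]) (h : ℤ) (j : Fin (N + 1)) : ℂ :=
  if 0 ≤ h + j then (Polynomial.taylor z (c j)).coeff (h + j).toNat else 0

theorem eval_eq_eval_taylor (z x : ℂ) (p : ℂ[X]) :
    p.eval x = (Polynomial.taylor z p).eval (x - z) := by
  simp [Polynomial.taylor_apply, Polynomial.eval_comp]

/-- The hypothesis makes `c j` divisible by `(x - z)^(h + j)`. When `h + j < 0` the compensating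
positive power goes into `v`, which then vanishes at `z`, in agreement with the default value of
`indicialCoeff`. -/
theorem exists_eval_eq_zpow_mul {N : ℕ} {z : ℂ} {c : Fin (N + 1) → ℂ[X]} {h : ℤ}
    (hc : ∀ (j : Fin (N + 1)) (i : ℕ), (i : ℤ) - j < h → (Polynomial.taylor z (c j)).coeff i = 0)
    (j : Fin (N + 1)) : ∃ v : ℂ → ℂ, Continuous v ∧ v z = indicialCoeff z c h j ∧
      ∀ x ≠ z, (c j).eval x = (x - z) ^ (h + j) * v x := by
  by_cases hj : 0 ≤ h + j
  · obtain ⟨k, hk⟩ := Int.eq_ofNat_of_zero_le hj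
    have hdvd : Polynomial.X ^ k ∣ Polynomial.taylor z (c j) := by
      rw [Polynomial.X_pow_dvd_iff]
      exact fun i hi => hc j i (by omega)
    obtain ⟨q, hq⟩ := hdvd
    refine ⟨fun x => q.eval (x - z), by fun_prop, ?_, fun x _ => ?_⟩
    · have h1 : (Polynomial.taylor z (c j)).coeff k = q.coeff 0 := by
        rw [hq, Polynomial.coeff_X_pow_mul', if_pos le_rfl, Nat.sub_self]
      simp only [sub_self, ← Polynomial.coeff_zero_eq_eval_zero, indicialCoeff, if_pos hj]
      rw [hk, ← h1]
      rfl
    · rw [eval_eq_eval_taylor z, hq, hk]; simp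
  · refine ⟨fun x => (x - z) ^ (-(h + j)).toNat * (c j).eval x, by fun_prop, ?_, fun x hx => ?_⟩ <;>
      dsimp only
    · have : (-(h + j)).toNat ≠ 0 := by omega
      rw [indicialCoeff, if_neg hj, sub_self, zero_pow this, zero_mul]
    · have h1 : x - z ≠ 0 := sub_ne_zero.2 hx
      rw [← zpow_natCast, Int.toNat_of_nonneg (by omega), ← mul_assoc, ← zpow_add₀ h1]
      simp

/-- The orders at `z` of the solutions of a differential equation are roots of its indicial
polynomial at `z`. -/
theorem sum_indicialCoeff_eq_zero {N : ℕ} {z : ℂ} {c : Fin (N + 1) → ℂ[X]} {h : ℤ}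
    (hc : ∀ (j : Fin (N + 1)) (i : ℕ), (i : ℤ) - j < h → (Polynomial.taylor z (c j)).coeff i = 0)
    {f : ℂ → ℂ} (hf : Differentiable ℂ f) {s : ℕ}
    (hs : meromorphicOrderAt f z = ((s : ℤ) : WithTop ℤ)) (hcf : Annihilates c f) :
    ∑ j, indicialCoeff z c h j * (s.descFactorial j : ℂ) = 0 := by
  obtain ⟨u, hu, huz, hfu⟩ := exists_eq_pow_mul_entire hf hs
  choose v hv hvz hfv using fun j => exists_iteratedDeriv_eq_zpow_mul hu hfu j
  choose w hw hwz hcw using exists_eval_eq_zpow_mul hc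
  have hcont : Continuous fun x => ∑ j : Fin (N + 1), w j x * v j x :=
    continuous_finsetSum _ fun j _ => (hw j).mul (hv j).continuous
  -- All terms share the factor `(x - z)^(s + h)`; it cancels off `z`, and the limit at `z` leaves
  -- the indicial sum times `u z`.
  have hzero : ∀ x ≠ z, ∑ j : Fin (N + 1), w j x * v j x = 0 := by
    intro x hx
    have h1 : x - z ≠ 0 := sub_ne_zero.2 hx
    have h2 := hcf x
    have h3 : ∀ j : Fin (N + 1), (c j).eval x * iteratedDeriv (j : ℕ) f x =
        (x - z) ^ (s + h) * (w j x * v j x) := by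
      intro j
      rw [hcw j x hx, hfv j x hx, show (s : ℤ) + h = (h + j) + (s - j) by ring,
        zpow_add₀ h1 (h + (j : ℤ))]
      exact mul_mul_mul_comm _ _ _ _
    simp only [h3, ← Finset.mul_sum] at h2
    exact (mul_eq_zero.1 h2).resolve_left (zpow_ne_zero _ h1)
  have hz : ∑ j : Fin (N + 1), w j z * v j z = 0 := by
    have h1 : Tendsto (fun x => ∑ j : Fin (N + 1), w j x * v j x) (𝓝[≠] z)
        (𝓝 (∑ j : Fin (N + 1), w j z * v j z)) := hcont.continuousAt.tendsto.mono_left inf_le_left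
    refine tendsto_nhds_unique h1 (tendsto_const_nhds.congr' ?_)
    filter_upwards [self_mem_nhdsWithin] with x hx using (hzero x hx).symm
  simp only [hwz, hvz, ← mul_assoc, ← Finset.sum_mul] at hz
  exact (mul_eq_zero.1 hz).resolve_right huz

/-! ### Quasi-polynomials -/

/-- `∂ + lam` on polynomials, that is, the derivation of `p exp (lam x)`. -/
def twistedDerivative (lam : ℂ) : Module.End ℂ ℂ[X] :=
  Polynomial.derivative + algebraMap ℂ (Module.End ℂ ℂ[X]) lam

/-- The function `p exp (lam x)`. -/
def quasiPolynomial (p : ℂ[X]) (lam : ℂ) (x : ℂ) : ℂ := p.eval x * Complex.exp (lam * x)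

theorem differentiable_quasiPolynomial (p : ℂ[X]) (lam : ℂ) :
    Differentiable ℂ (quasiPolynomial p lam) := by
  unfold quasiPolynomial; fun_prop

theorem iteratedDeriv_quasiPolynomial (p : ℂ[X]) (lam : ℂ) (j : ℕ) :
    iteratedDeriv j (quasiPolynomial p lam) =
      quasiPolynomial ((twistedDerivative lam ^ j) p) lam := by
  induction j with
  | zero => simp
  | succ j ih =>
    rw [iteratedDeriv_succ, ih, pow_succ', Module.End.mul_apply]
    set q := (twistedDerivative lam ^ j) p
    funext x
    have h : HasDerivAt (quasiPolynomial q lam)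
        (q.derivative.eval x * Complex.exp (lam * x) +
          q.eval x * (Complex.exp (lam * x) * (lam * 1))) x :=
      (q.hasDerivAt x).mul (((hasDerivAt_id x).const_mul lam).cexp)
    rw [h.deriv]
    simp [quasiPolynomial, twistedDerivative]
    ring

theorem quasiPolynomial_eq_zero {p : ℂ[X]} {lam : ℂ} (h : quasiPolynomial p lam = 0) : p = 0 := by
  refine Polynomial.funext fun x => ?_
  have := congrFun h x
  simpa [quasiPolynomial, Complex.exp_ne_zero] using this

/-- Conjugation by `exp(lam x)` shifts `∂` by `lam`, so the Taylor coefficients at `lam` of a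
polynomial in `∂` govern its action on the polynomial factor. -/
theorem aeval_twistedDerivative (lam : ℂ) (q : ℂ[X]) :
    Polynomial.aeval (twistedDerivative lam) q =
      Polynomial.aeval (Polynomial.derivative : Module.End ℂ ℂ[X]) (Polynomial.taylor lam q) := by
  rw [Polynomial.taylor_apply, Polynomial.aeval_comp]
  simp [twistedDerivative]

/-- The coefficient of `x ^ i` in `∑ c j ∂ ^ j`, as a polynomial in `∂`. -/
def dualCoeff {N : ℕ} (c : Fin (N + 1) → ℂ[X]) (i : ℕ) : ℂ[X] :=
  ∑ j : Fin (N + 1), Polynomial.monomial (j : ℕ) ((c j).coeff i)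

theorem coeff_dualCoeff {N : ℕ} (c : Fin (N + 1) → ℂ[X]) (i : ℕ) (j : Fin (N + 1)) :
    (dualCoeff c i).coeff j = (c j).coeff i := by
  simp [dualCoeff, Polynomial.coeff_monomial, Fin.val_inj]

theorem natDegree_dualCoeff_lt {N : ℕ} (c : Fin (N + 1) → ℂ[X]) (i : ℕ) :
    (dualCoeff c i).natDegree < N + 1 := by
  refine Nat.lt_succ_of_le (Polynomial.natDegree_sum_le_of_forall_le _ _ fun j _ => ?_)
  exact (Polynomial.natDegree_monomial_le _).trans (Nat.le_of_lt_succ j.2)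

/-- The operator is regrouped by powers of `x`, and the exponential is cancelled. -/
theorem sum_X_pow_mul_dualCoeff_eq_zero {N d : ℕ} {c : Fin (N + 1) → ℂ[X]}
    (hd : ∀ j, (c j).natDegree < d) {p : ℂ[X]} {lam : ℂ}
    (h : Annihilates c (quasiPolynomial p lam)) :
    ∑ i ∈ Finset.range d, Polynomial.X ^ i * ∑ j : Fin (N + 1),
      (Polynomial.taylor lam (dualCoeff c i)).coeff j • Polynomial.derivative^[j] p = 0 := by
  have h1 : ∑ j, c j * (twistedDerivative lam ^ (j : ℕ)) p = 0 := by
    refine quasiPolynomial_eq_zero (lam := lam) ?_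
    funext x
    have := h x
    simp only [iteratedDeriv_quasiPolynomial] at this
    simp only [quasiPolynomial, ← mul_assoc, ← Finset.sum_mul] at this
    simpa [quasiPolynomial, Polynomial.eval_finsetSum] using this
  rw [← h1]
  have h2 : ∀ i, ∑ j : Fin (N + 1), (Polynomial.taylor lam (dualCoeff c i)).coeff j •
      Polynomial.derivative^[j] p = ∑ j : Fin (N + 1), (c j).coeff i •
        (twistedDerivative lam ^ (j : ℕ)) p := by
    intro i
    have h3 : Polynomial.aeval (twistedDerivative lam) (dualCoeff c i) p =
        ∑ j : Fin (N + 1), (c j).coeff i • (twistedDerivative lam ^ (j : ℕ)) p := by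
      simp [dualCoeff, Polynomial.aeval_monomial]
    rw [← h3, aeval_twistedDerivative, Polynomial.aeval_eq_sum_range' (n := N + 1)
      (by rw [Polynomial.natDegree_taylor]; exact natDegree_dualCoeff_lt c i),
      Finset.sum_range]
    simp [Module.End.pow_apply]
  simp only [h2, Finset.mul_sum]
  rw [Finset.sum_comm]
  refine Finset.sum_congr rfl fun j _ => ?_
  conv_rhs => rw [Polynomial.as_sum_range_C_mul_X_pow' (c j) (hd j)]
  rw [Finset.sum_mul]
  refine Finset.sum_congr rfl fun i _ => ?_
  rw [Polynomial.smul_eq_C_mul]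
  ring

/-- The coefficients, with respect to falling factorials, of the polynomial which describes the
action of the terms of degree `k` of the operator `∑ c j ∂ ^ j` on functions `p exp (lam x)`. -/
def indicialCoeffInfty {N : ℕ} (lam : ℂ) (c : Fin (N + 1) → ℂ[X]) (k : ℤ) (j : Fin (N + 1)) : ℂ :=
  if 0 ≤ k + j then (Polynomial.taylor lam (dualCoeff c (k + j).toNat)).coeff j else 0

theorem dualCoeff_eq_zero {N d : ℕ} {c : Fin (N + 1) → ℂ[X]} (hd : ∀ j, (c j).natDegree < d)
    {i : ℕ} (hi : d ≤ i) : dualCoeff c i = 0 := by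
  refine Finset.sum_eq_zero fun j _ => ?_
  rw [Polynomial.coeff_eq_zero_of_natDegree_lt ((hd j).trans_le hi), Polynomial.monomial_zero_right]

/-- Compare coefficients of `x^(s + k)`, where `s` is the degree of `p`. Terms with `i - j > k`
vanish by hypothesis, and those with `i - j < k` would need coefficients of `p` beyond its degree;
only `i - j = k` remains, acting on the leading term. -/
theorem sum_indicialCoeffInfty_eq_zero {N : ℕ} {c : Fin (N + 1) → ℂ[X]} {p : ℂ[X]} {lam : ℂ}
    {k : ℤ} (hk : ∀ i j : ℕ, k < (i : ℤ) - j → (Polynomial.taylor lam (dualCoeff c i)).coeff j = 0)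
    (hp : p ≠ 0) (h : Annihilates c (quasiPolynomial p lam)) :
    ∑ j, indicialCoeffInfty lam c k j * (p.natDegree.descFactorial j : ℂ) = 0 := by
  set s := p.natDegree with hs
  obtain ⟨d, hd⟩ : ∃ d, ∀ j, (c j).natDegree < d :=
    ⟨(Finset.univ.sup fun j => (c j).natDegree) + 1, fun j =>
      Nat.lt_succ_of_le (Finset.le_sup (f := fun j => (c j).natDegree) (Finset.mem_univ j))⟩
  by_cases hsk : 0 ≤ (s : ℤ) + k
  · obtain ⟨t, ht⟩ := Int.eq_ofNat_of_zero_le hsk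
    have h1 := congrArg (fun q => q.coeff t) (sum_X_pow_mul_dualCoeff_eq_zero hd h)
    simp only [Finset.mul_sum, Polynomial.finsetSum_coeff, Polynomial.coeff_zero] at h1
    rw [Finset.sum_comm] at h1
    have h2 : ∀ j : Fin (N + 1), ∑ i ∈ Finset.range d, (Polynomial.X ^ i *
        (Polynomial.taylor lam (dualCoeff c i)).coeff j • Polynomial.derivative^[j] p).coeff t =
        indicialCoeffInfty lam c k j * (s.descFactorial j : ℂ) * p.leadingCoeff := by
      intro j
      have hterm : ∀ i : ℕ, (Polynomial.X ^ i * (Polynomial.taylor lam (dualCoeff c i)).coeff j •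
          Polynomial.derivative^[j] p).coeff t = if (i : ℤ) = k + j then
          (Polynomial.taylor lam (dualCoeff c i)).coeff j * (s.descFactorial j : ℂ) *
            p.leadingCoeff else 0 := by
        intro i
        rw [Polynomial.coeff_X_pow_mul']
        split_ifs with hit hij hij
        · rw [Polynomial.coeff_smul, Polynomial.coeff_iterate_derivative,
            show t - i + j = s by omega, smul_eq_mul, nsmul_eq_mul, Polynomial.leadingCoeff, ← hs,
            mul_assoc]
        · rw [Polynomial.coeff_smul, Polynomial.coeff_iterate_derivative]
          rcases lt_or_gt_of_ne hij with hlt | hgt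
          · rw [Polynomial.coeff_eq_zero_of_natDegree_lt (n := t - i + j) (by omega)]; simp
          · rw [hk i j (by omega), zero_smul]
        · rw [Nat.descFactorial_eq_zero_iff_lt.2 (by omega)]; simp
        · rfl
      simp only [hterm]
      unfold indicialCoeffInfty
      split_ifs with hkj
      · obtain ⟨i, hi⟩ := Int.eq_ofNat_of_zero_le hkj
        rw [hi, Int.toNat_natCast]
        by_cases hid : i < d
        · rw [Finset.sum_eq_single i]
          · simp
          · intro i' _ hi'
            rw [if_neg (by exact_mod_cast hi')]
          · intro hi'; exact absurd (Finset.mem_range.2 hid) hi'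
        · rw [dualCoeff_eq_zero hd (not_lt.1 hid), Finset.sum_eq_zero]
          · simp
          · intro i' hi'
            rw [if_neg]
            have := Finset.mem_range.1 hi'
            intro h; omega
      · rw [Finset.sum_eq_zero]
        · simp
        · intro i _
          rw [if_neg (by omega)]
    simp only [h2, ← Finset.sum_mul] at h1
    exact (mul_eq_zero.1 h1).resolve_right (Polynomial.leadingCoeff_ne_zero.2 hp)
  -- Now `s + k < 0`, so `0 ≤ k + j` forces `j > s` and the falling factorial vanishes.
  · refine Finset.sum_eq_zero fun j _ => ?_
    unfold indicialCoeffInfty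
    split_ifs with hkj
    · rw [Nat.descFactorial_eq_zero_iff_lt.2 (by omega)]; simp
    · simp

/-! ### The leading coefficient of an operator annihilating a space -/

/-- The degrees `i - j` of the terms `(x - z)^i ∂^j` are at least `-N`, so a least one occurs. -/
theorem exists_indicial_degree {N : ℕ} {c : Fin (N + 1) → ℂ[X]} (hc : c ≠ 0) (z : ℂ) :
    ∃ h : ℤ, (∀ (j : Fin (N + 1)) (i : ℕ), (i : ℤ) - j < h →
      (Polynomial.taylor z (c j)).coeff i = 0) ∧ indicialCoeff z c h ≠ 0 := by
  have hne : ∃ h : ℤ, ∃ (j : Fin (N + 1)) (i : ℕ), (i : ℤ) - j = h ∧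
      (Polynomial.taylor z (c j)).coeff i ≠ 0 := by
    obtain ⟨j, hj⟩ := Function.ne_iff.1 hc
    have h1 : Polynomial.taylor z (c j) ≠ 0 := (Polynomial.taylor_eq_zero z (c j)).not.2 hj
    exact ⟨_, j, _, rfl, Polynomial.leadingCoeff_ne_zero.2 h1⟩
  have hbdd : ∃ b : ℤ, ∀ h : ℤ, (∃ (j : Fin (N + 1)) (i : ℕ), (i : ℤ) - j = h ∧
      (Polynomial.taylor z (c j)).coeff i ≠ 0) → b ≤ h := by
    refine ⟨-N, ?_⟩
    rintro h ⟨j, i, rfl, -⟩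
    have := j.2
    omega
  obtain ⟨h, ⟨j, i, hji, hne'⟩, hmin⟩ := Int.exists_least_of_bdd hbdd hne
  refine ⟨h, fun j' i' hlt => ?_, fun h0 => hne' ?_⟩
  · by_contra hcon
    exact absurd (hmin _ ⟨j', i', rfl, hcon⟩) (by omega)
  · have h1 := congrFun h0 j
    rw [indicialCoeff, if_pos (by omega), show (h + j).toNat = i by omega] at h1
    exact h1

section Local

variable {N : ℕ} {W : Submodule ℂ (ℂ → ℂ)} {c : Fin (N + 1) → ℂ[X]} {z : ℂ}

theorem exists_exponents_finset (hW : W ≤ entireFunctions) [FiniteDimensional ℂ W]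
    (hdim : Module.finrank ℂ W = N) (z : ℂ) :
    ∃ S : Finset ℕ, S.card = N ∧ ∀ s : ℕ, s ∈ S ↔ (s : ℤ) ∈ exponents W z := by
  obtain ⟨b, e, he, -, hexp⟩ := exists_adapted_basis hW hdim z
  refine ⟨Finset.univ.image e, by simp [Finset.card_image_of_injective _ he], fun s => ?_⟩
  simp [hexp]

theorem sum_indicialCoeff_of_mem_exponents (hW : W ≤ entireFunctions)
    (hcW : ∀ f ∈ W, Annihilates c f) {h : ℤ}
    (hc : ∀ (j : Fin (N + 1)) (i : ℕ), (i : ℤ) - j < h → (Polynomial.taylor z (c j)).coeff i = 0)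
    {s : ℕ} (hs : (s : ℤ) ∈ exponents W z) :
    ∑ j, indicialCoeff z c h j * (s.descFactorial j : ℂ) = 0 := by
  obtain ⟨f, hf, hfs⟩ := hs
  exact sum_indicialCoeff_eq_zero hc (hW hf) hfs (hcW f hf)

/-- Without this coefficient the indicial polynomial would have degree below `N` and still the `N`
exponents as roots. -/
theorem indicialCoeff_last_ne_zero (hW : W ≤ entireFunctions) [FiniteDimensional ℂ W]
    (hdim : Module.finrank ℂ W = N) (hcW : ∀ f ∈ W, Annihilates c f) {h : ℤ}
    (hc : ∀ (j : Fin (N + 1)) (i : ℕ), (i : ℤ) - j < h → (Polynomial.taylor z (c j)).coeff i = 0)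
    (hne : indicialCoeff z c h ≠ 0) : indicialCoeff z c h (Fin.last N) ≠ 0 := by
  obtain ⟨S, hS, hSe⟩ := exists_exponents_finset hW hdim z
  intro h0
  refine hne (eq_zero_of_sum_descFactorial_eq_zero S (fun s hs =>
    sum_indicialCoeff_of_mem_exponents hW hcW hc ((hSe s).1 hs)) fun j hj => ?_)
  rw [hS] at hj
  rwa [show j = Fin.last N from Fin.ext (by have := j.2; rw [Fin.val_last]; omega)]

theorem last_ne_zero_of_annihilates (hW : W ≤ entireFunctions) [FiniteDimensional ℂ W]
    (hdim : Module.finrank ℂ W = N) (hcW : ∀ f ∈ W, Annihilates c f) (hc : c ≠ 0) :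
    c (Fin.last N) ≠ 0 := by
  obtain ⟨h, hh, hne⟩ := exists_indicial_degree hc 0
  intro h0
  apply indicialCoeff_last_ne_zero hW hdim hcW hh hne
  simp [indicialCoeff, h0]

theorem rootMultiplicity_eq_of_coeff_taylor {p : ℂ[X]} {k : ℕ}
    (hlt : ∀ i < k, (Polynomial.taylor z p).coeff i = 0)
    (hk : (Polynomial.taylor z p).coeff k ≠ 0) : p.rootMultiplicity z = k := by
  rw [Polynomial.rootMultiplicity_eq_natTrailingDegree]
  change (Polynomial.taylor z p).natTrailingDegree = k
  refine le_antisymm (Polynomial.natTrailingDegree_le_of_ne_zero hk) ?_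
  refine Polynomial.le_natTrailingDegree (fun h => hk (by rw [h, Polynomial.coeff_zero])) hlt

/-- If the exponents at `z` are `0, …, N - k - 1` and integers greater than `N - k`, then the
leading coefficient of a primitive operator annihilating `W` vanishes to order `k` at `z`. -/
theorem rootMultiplicity_last_eq (hW : W ≤ entireFunctions) [FiniteDimensional ℂ W]
    (hdim : Module.finrank ℂ W = N) (hcW : ∀ f ∈ W, Annihilates c f)
    (hcz : ∃ j, (c j).eval z ≠ 0) {k : ℕ} (hkN : k ≤ N)
    (hlow : ∀ s : ℕ, s + k < N → (s : ℤ) ∈ exponents W z)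
    (hgap : ((N - k : ℕ) : ℤ) ∉ exponents W z) :
    (c (Fin.last N)).rootMultiplicity z = k := by
  classical
  have hc0 : c ≠ 0 := by rintro rfl; simp at hcz
  obtain ⟨h, hh, hne⟩ := exists_indicial_degree hc0 z
  have hlast := indicialCoeff_last_ne_zero hW hdim hcW hh hne
  have hroot : ∀ s : ℕ, (s : ℤ) ∈ exponents W z →
      ∑ j, indicialCoeff z c h j * (s.descFactorial j : ℂ) = 0 :=
    fun s hs => sum_indicialCoeff_of_mem_exponents hW hcW hh hs
  have hlastN : 0 ≤ h + N := by
    by_contra hcon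
    exact hlast (by rw [indicialCoeff, if_neg (by simpa using hcon)])
  have hmult : (c (Fin.last N)).rootMultiplicity z = (h + N).toNat := by
    refine rootMultiplicity_eq_of_coeff_taylor (fun i hi => hh _ _ ?_) ?_
    · rw [Fin.val_last]; omega
    · rw [indicialCoeff, if_pos (by simpa using hlastN)] at hlast
      simpa using hlast
  -- The roots `0, …, N - k - 1` kill the shortest falling factorials one after another.
  have hβ : ∀ (s : ℕ) (hs : s < N + 1), s + k < N → indicialCoeff z c h ⟨s, hs⟩ = 0 := by
    intro s
    induction s using Nat.strong_induction_on with
    | _ s ih =>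
      intro hs hsk
      have h1 := hroot s (hlow s hsk)
      rw [Finset.sum_eq_single ⟨s, hs⟩] at h1
      · simpa [Nat.factorial_ne_zero] using h1
      · intro j _ hj
        rcases lt_trichotomy (j : ℕ) s with h2 | h2 | h2
        · rw [show j = ⟨j, j.2⟩ from rfl, ih j h2 _ (by omega), zero_mul]
        · exact absurd (Fin.ext h2) hj
        · rw [Nat.descFactorial_eq_zero_iff_lt.2 h2]; simp
      · simp
  have hNk : N - k < N + 1 := by omega
  -- Otherwise only falling factorials longer than `N - k` would be left, and `N - k` would be an
  -- additional root, making `N + 1` in all.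
  have hmid : indicialCoeff z c h ⟨N - k, hNk⟩ ≠ 0 := by
    intro h0
    obtain ⟨S, hS, hSe⟩ := exists_exponents_finset hW hdim z
    have hnot : N - k ∉ S := fun h1 => hgap ((hSe _).1 h1)
    refine hne (eq_zero_of_sum_descFactorial_eq_zero (insert (N - k) S) (fun s hs => ?_)
      fun j hj => ?_)
    · rcases Finset.mem_insert.1 hs with rfl | hs
      · refine Finset.sum_eq_zero fun j _ => ?_
        rcases lt_trichotomy (j : ℕ) (N - k) with h2 | h2 | h2
        · rw [show j = ⟨j, j.2⟩ from rfl, hβ j _ (by omega), zero_mul]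
        · rw [show j = ⟨N - k, hNk⟩ from Fin.ext h2, h0, zero_mul]
        · rw [Nat.descFactorial_eq_zero_iff_lt.2 h2]; simp
      · exact hroot s ((hSe s).1 hs)
    · rw [Finset.card_insert_of_notMem hnot, hS] at hj
      have := j.2
      omega
  have hge : 0 ≤ h + (N - k : ℕ) := by
    by_contra hcon
    exact hmid (by rw [indicialCoeff, if_neg hcon])
  rw [hmult]
  by_contra hk
  -- At this point `h + N ≥ k` is known, so a failure means `h + N > k`. Then `c j` vanishes at `z`
  -- for `j ≥ N - k` because its constant term has degree below `h`. For smaller `j`, taken in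
  -- descending order, a solution of order `j` at `z` isolates the value of `c j`. This contradicts
  -- primitivity.
  have hall : ∀ (d : ℕ) (j : Fin (N + 1)), (j : ℕ) + d = N → (c j).eval z = 0 := by
    intro d
    induction d using Nat.strong_induction_on with
    | _ d ih =>
      intro j hjd
      by_cases hj : (j : ℕ) + k < N
      · obtain ⟨f, hf, hfs⟩ := hlow j hj
        have h1 := hcW f hf z
        have h2 := (meromorphicOrderAt_eq_iff_iteratedDeriv (hW hf) z _).1 hfs
        rw [Finset.sum_eq_single j] at h1
        · exact (mul_eq_zero.1 h1).resolve_right h2.2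
        · intro i _ hij
          rcases lt_or_gt_of_ne (fun h => hij (Fin.ext h) : (i : ℕ) ≠ j) with hlt | hgt
          · rw [h2.1 _ hlt, mul_zero]
          · rw [ih (N - i) (by omega) i (by omega), zero_mul]
        · simp
      · have := hh j 0 (by push_cast; omega)
        simpa using this
  obtain ⟨j, hj⟩ := hcz
  exact hj (hall (N - j) j (by omega))

end Local

/-! ### Behaviour at infinity -/

section Infinity

variable {N : ℕ} {c : Fin (N + 1) → ℂ[X]} {lam : ℂ}

theorem coeff_taylor_dualCoeff_of_lt {i j : ℕ} (hj : N < j) :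
    (Polynomial.taylor lam (dualCoeff c i)).coeff j = 0 := by
  refine Polynomial.coeff_eq_zero_of_natDegree_lt ?_
  rw [Polynomial.natDegree_taylor]
  have := natDegree_dualCoeff_lt c i
  omega

/-- Descend through the degrees `K, K - 1, …`. In degree `K - n` only `j ≤ n` can occur, since `i =
K - n + j` is at most `K`; the polynomial at infinity then has degree at most `n < S.card` and
vanishes on `S`. -/
theorem coeff_taylor_dualCoeff_eq_zero {K : ℕ} (hK : ∀ i, K < i → dualCoeff c i = 0)
    {S : Finset ℕ} (hS : ∀ s ∈ S, ∃ p : ℂ[X], p ≠ 0 ∧ p.natDegree = s ∧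
      Annihilates c (quasiPolynomial p lam)) {i j : ℕ} (hij : (K : ℤ) - S.card < (i : ℤ) - j) :
    (Polynomial.taylor lam (dualCoeff c i)).coeff j = 0 := by
  suffices H : ∀ n ≤ S.card, ∀ i j : ℕ, (K : ℤ) - n < (i : ℤ) - j →
      (Polynomial.taylor lam (dualCoeff c i)).coeff j = 0 from H _ le_rfl i j hij
  intro n
  induction n with
  | zero =>
    intro _ i j h
    rw [hK i (by push_cast at h; omega)]; simp
  | succ n ih =>
    intro hn i j h
    have ih' := ih (by omega)
    by_cases hlt : (K : ℤ) - n < (i : ℤ) - j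
    · exact ih' i j hlt
    have heq : (i : ℤ) = (K : ℤ) - n + j := by push_cast at h; omega
    have hβ : indicialCoeffInfty lam c ((K : ℤ) - n) = 0 := by
      refine eq_zero_of_sum_descFactorial_eq_zero S (fun s hs => ?_) fun j hj => ?_
      · obtain ⟨p, hp, rfl, hcp⟩ := hS s hs
        exact sum_indicialCoeffInfty_eq_zero ih' hp hcp
      · rw [indicialCoeffInfty]
        split_ifs with h0
        · rw [hK _ (by omega)]; simp
        · rfl
    by_cases hj : j < N + 1
    · have h1 := congrFun hβ ⟨j, hj⟩
      rw [indicialCoeffInfty, if_pos (by simp; omega)] at h1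
      simp only [← heq, Int.toNat_natCast] at h1
      exact h1
    · exact coeff_taylor_dualCoeff_of_lt (by omega)

theorem X_sub_C_pow_dvd_dualCoeff {K : ℕ} (hK : ∀ i, K < i → dualCoeff c i = 0)
    {S : Finset ℕ} (hS : ∀ s ∈ S, ∃ p : ℂ[X], p ≠ 0 ∧ p.natDegree = s ∧
      Annihilates c (quasiPolynomial p lam)) :
    (Polynomial.X - Polynomial.C lam) ^ S.card ∣ dualCoeff c K := by
  rw [Polynomial.X_sub_C_pow_dvd_iff, Polynomial.X_pow_dvd_iff]
  exact fun j hj => coeff_taylor_dualCoeff_eq_zero hK hS (by omega)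

/-- In degree `K - S.card` the polynomial at infinity is nonzero of degree at most `S.card`, so `S`
exhausts its roots. Hence `0` is not a root, and the constant term, which is the value at `lam` of
the coefficient of `x^(K - S.card)`, is nonzero. -/
theorem card_le_and_eval_dualCoeff_ne_zero {K : ℕ} (hK : ∀ i, K < i → dualCoeff c i = 0)
    {S : Finset ℕ} (hS : ∀ s ∈ S, ∃ p : ℂ[X], p ≠ 0 ∧ p.natDegree = s ∧
      Annihilates c (quasiPolynomial p lam)) (h0 : 0 ∉ S)
    (hKS : (Polynomial.taylor lam (dualCoeff c K)).coeff S.card ≠ 0) :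
    S.card ≤ K ∧ (dualCoeff c (K - S.card)).eval lam ≠ 0 ∧
      ∀ s : ℕ, ∑ j, indicialCoeffInfty lam c ((K : ℤ) - S.card) j * (s.descFactorial j : ℂ) = 0 →
        s ∈ S := by
  have hN : S.card < N + 1 := by
    by_contra hN
    exact hKS (coeff_taylor_dualCoeff_of_lt (by omega))
  have hne : indicialCoeffInfty lam c ((K : ℤ) - S.card) ≠ 0 := by
    intro h
    have h1 := congrFun h ⟨S.card, hN⟩
    rw [indicialCoeffInfty, if_pos (by simp)] at h1
    simp only [sub_add_cancel, Int.toNat_natCast] at h1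
    exact hKS h1
  have hroot : ∀ s : ℕ, ∑ j, indicialCoeffInfty lam c ((K : ℤ) - S.card) j *
      (s.descFactorial j : ℂ) = 0 → s ∈ S := by
    intro s hs
    by_contra hsS
    refine hne (eq_zero_of_sum_descFactorial_eq_zero (insert s S) (fun t ht => ?_) fun j hj => ?_)
    · rcases Finset.mem_insert.1 ht with rfl | ht
      · exact hs
      · obtain ⟨p, hp, rfl, hcp⟩ := hS t ht
        exact sum_indicialCoeffInfty_eq_zero
          (fun i j hij => coeff_taylor_dualCoeff_eq_zero hK hS hij) hp hcp
    · rw [Finset.card_insert_of_notMem hsS] at hj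
      rw [indicialCoeffInfty]
      split_ifs with h1
      · rw [hK _ (by omega)]; simp
      · rfl
  have hβ0 : indicialCoeffInfty lam c ((K : ℤ) - S.card) 0 ≠ 0 := by
    intro hβ
    refine h0 (hroot 0 (Finset.sum_eq_zero fun j _ => ?_))
    rcases eq_or_ne j 0 with rfl | hj
    · rw [hβ, zero_mul]
    · have hj' : 0 < (j : ℕ) := Fin.pos_iff_ne_zero.2 hj
      rw [Nat.descFactorial_eq_zero_iff_lt.2 hj']; simp
  rw [indicialCoeffInfty] at hβ0
  -- The default value `0`, taken when `K < S.card`, is incompatible with a nonzero constant term.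
  split_ifs at hβ0 with h1
  · rw [show ((K : ℤ) - S.card + ((0 : Fin (N + 1)) : ℕ)).toNat = K - S.card by
      simp] at hβ0
    refine ⟨by simp at h1; omega, by simpa using hβ0, hroot⟩
  · exact absurd rfl hβ0

/-- A falling factorial of length `k + j` at `s` is the one of length `k` at `s` times the one of
length `j` at `s - k`. The term `i = k + j` of the dual sum thus matches the term `j` at infinity.
-/
theorem sum_indicialCoeff_dual {M k : ℕ} (hM : ∀ i, M < i → dualCoeff c i = 0) (s : ℕ) :
    ∑ i : Fin (M + 1), indicialCoeff lam (fun i : Fin (M + 1) => dualCoeff c i) (-(k : ℤ)) i *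
      (s.descFactorial i : ℂ) = s.descFactorial k *
        ∑ j, indicialCoeffInfty lam c k j * ((s - k).descFactorial j : ℂ) := by
  set b : ℕ → ℕ → ℂ := fun i j => (Polynomial.taylor lam (dualCoeff c i)).coeff j with hb
  have hL : ∀ i : Fin (M + 1), indicialCoeff lam (fun i : Fin (M + 1) => dualCoeff c i) (-(k : ℤ)) i
      * (s.descFactorial i : ℂ) =
      (fun i : ℕ => if k ≤ i then b i (i - k) * (s.descFactorial i : ℂ) else 0) i := by
    intro i
    simp only [indicialCoeff]
    split_ifs with h1 h2 h2
    · rw [show (-(k : ℤ) + i).toNat = i - k by omega]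
    · omega
    · omega
    · simp
  have hR : ∀ j : Fin (N + 1), indicialCoeffInfty lam c k j * ((s - k).descFactorial j : ℂ) =
      (fun j : ℕ => b (k + j) j * ((s - k).descFactorial j : ℂ)) j := by
    intro j
    simp only [indicialCoeffInfty]
    rw [if_pos (by omega), show ((k : ℤ) + j).toNat = k + j by omega]
  rw [Finset.sum_congr rfl fun i _ => hL i, Finset.sum_congr rfl fun j _ => hR j,
    ← Finset.sum_range fun i : ℕ => if k ≤ i then b i (i - k) * (s.descFactorial i : ℂ) else 0,
    ← Finset.sum_range fun j : ℕ => b (k + j) j * ((s - k).descFactorial j : ℂ)]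
  have hL' : ∑ i ∈ Finset.range (M + 1),
      (if k ≤ i then b i (i - k) * (s.descFactorial i : ℂ) else 0) =
      ∑ i ∈ Finset.range (k + (M + N + 1)),
        (if k ≤ i then b i (i - k) * (s.descFactorial i : ℂ) else 0) := by
    refine Finset.sum_subset (Finset.range_mono (by omega)) fun i _ hi => ?_
    have : dualCoeff c i = 0 := hM i (by simpa using hi)
    simp [hb, this]
  have hR' : ∑ j ∈ Finset.range (N + 1), b (k + j) j * ((s - k).descFactorial j : ℂ) =
      ∑ j ∈ Finset.range (M + N + 1), b (k + j) j * ((s - k).descFactorial j : ℂ) := by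
    refine Finset.sum_subset (Finset.range_mono (by omega)) fun j _ hj => ?_
    have : b (k + j) j = 0 := coeff_taylor_dualCoeff_of_lt (by simpa using hj)
    rw [this, zero_mul]
  rw [hL', hR', Finset.sum_range_add, Finset.sum_eq_zero, zero_add, Finset.mul_sum]
  · refine Finset.sum_congr rfl fun j _ => ?_
    rw [if_pos (by omega), Nat.add_sub_cancel_left,
      ← Nat.descFactorial_mul_descFactorial (Nat.le_add_right k j), Nat.add_sub_cancel_left]
    push_cast
    ring
  · intro i hi
    rw [if_neg (by simpa using hi)]

end Infinity

/-! ### Linear independence of quasi-polynomials -/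

/-- Differentiation lowers the degree, so the leading coefficient is just multiplied by `mu`. -/
theorem twistedDerivative_injective {mu : ℂ} (hmu : mu ≠ 0) :
    Function.Injective (twistedDerivative mu) := by
  rw [injective_iff_map_eq_zero]
  intro p hp
  have h := congrArg (fun q => q.coeff p.natDegree) hp
  simp only [twistedDerivative, LinearMap.add_apply, Module.algebraMap_end_apply,
    Polynomial.coeff_add, Polynomial.coeff_smul, Polynomial.coeff_derivative, Polynomial.coeff_zero,
    Polynomial.coeff_eq_zero_of_natDegree_lt (Nat.lt_succ_self p.natDegree), zero_mul, zero_add,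
    smul_eq_mul] at h
  exact Polynomial.leadingCoeff_eq_zero.1 ((mul_eq_zero.1 h).resolve_left hmu)

theorem quasiPolynomial_mul_exp (p : ℂ[X]) (lam mu : ℂ) (x : ℂ) :
    quasiPolynomial p (lam - mu) x = quasiPolynomial p lam x * Complex.exp (-(mu * x)) := by
  rw [quasiPolynomial, quasiPolynomial, mul_assoc, ← Complex.exp_add]
  ring_nf

/-- Divide by one exponential and differentiate until its polynomial disappears. On the other
polynomials these operations act injectively, so the induction hypothesis applies to the images. -/
theorem eq_zero_of_sum_quasiPolynomial_eq_zero {ι : Type*} (s : Finset ι) :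
    ∀ (lam : ι → ℂ) (P : ι → ℂ[X]), Function.Injective lam →
      (∀ x, ∑ i ∈ s, quasiPolynomial (P i) (lam i) x = 0) → ∀ i ∈ s, P i = 0 := by
  classical
  induction s using Finset.induction_on with
  | empty => simp
  | insert a s ha ih =>
    intro lam P hlam h
    have h1 : ∑ i ∈ s, (1 : ℂ) • quasiPolynomial (P i) (lam i - lam a) =
        (-1 : ℂ) • quasiPolynomial (P a) 0 := by
      funext x
      have h2 := h x
      rw [Finset.sum_insert ha] at h2
      have h3 : quasiPolynomial (P a) 0 x = quasiPolynomial (P a) (lam a) x *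
          Complex.exp (-(lam a * x)) := by
        rw [← quasiPolynomial_mul_exp, sub_self]
      simp only [one_smul, Finset.sum_apply, Pi.smul_apply, quasiPolynomial_mul_exp, h3,
        ← Finset.sum_mul, smul_eq_mul]
      linear_combination Complex.exp (-(lam a * x)) * h2
    set d := (P a).natDegree + 1 with hd
    have h4 : ∀ x, ∑ i ∈ s, quasiPolynomial ((twistedDerivative (lam i - lam a) ^ d) (P i))
        (lam i - lam a) x = 0 := by
      intro x
      have h5 := iteratedDeriv_sum_entire s (fun _ => 1)
        (fun i => quasiPolynomial (P i) (lam i - lam a))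
        (fun i => differentiable_quasiPolynomial _ _) d x
      rw [h1, iteratedDeriv_const_smul
        ((differentiable_quasiPolynomial _ _).contDiff (n := d)).contDiffAt] at h5
      simp only [iteratedDeriv_quasiPolynomial, one_mul] at h5
      rw [← h5]
      have h6 : (twistedDerivative 0 ^ d) (P a) = 0 := by
        rw [twistedDerivative, map_zero, add_zero, Module.End.pow_apply]
        exact Polynomial.iterate_derivative_eq_zero (Nat.lt_succ_self _)
      simp [h6, quasiPolynomial]
    have h7 := ih (fun i => lam i - lam a) _ (fun i j hij => hlam (sub_left_injective hij)) h4
    have h8 : ∀ i ∈ s, P i = 0 := by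
      intro i hi
      have hne : lam i - lam a ≠ 0 := sub_ne_zero.2 fun h => ha (hlam h ▸ hi)
      have hinj : Function.Injective (twistedDerivative (lam i - lam a) ^ d) := by
        rw [Module.End.coe_pow]
        exact (twistedDerivative_injective hne).iterate d
      exact hinj ((h7 i hi).trans (map_zero _).symm)
    intro i hi
    rcases Finset.mem_insert.1 hi with rfl | hi
    · refine quasiPolynomial_eq_zero (lam := lam i) (funext fun x => ?_)
      have h9 := h x
      rw [Finset.sum_insert ha, Finset.sum_eq_zero, add_zero] at h9
      · exact h9
      · intro j hj
        simp [h8 j hj, quasiPolynomial]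
    · exact h8 i hi

theorem linearIndependent_of_injective_natDegree {ι : Type*} {p : ι → ℂ[X]} (hp : ∀ i, p i ≠ 0)
    (hdeg : Function.Injective fun i => (p i).natDegree) : LinearIndependent ℂ p := by
  classical
  rw [linearIndependent_iff']
  intro t c hc
  by_contra! hne
  obtain ⟨i₀, hi₀, hc₀⟩ := hne
  obtain ⟨i, hi, hmax⟩ := Finset.exists_max_image (t.filter fun i => c i ≠ 0)
    (fun i => (p i).natDegree) ⟨i₀, by simp [hi₀, hc₀]⟩
  rw [Finset.mem_filter] at hi
  have h := congrArg (fun q => q.coeff (p i).natDegree) hc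
  simp only [Polynomial.finsetSum_coeff, Polynomial.coeff_smul, Polynomial.coeff_zero,
    smul_eq_mul] at h
  rw [Finset.sum_eq_single i] at h
  · exact mul_ne_zero hi.2 (Polynomial.leadingCoeff_ne_zero.2 (hp i)) h
  · intro j hj hji
    by_cases hcj : c j = 0
    · simp [hcj]
    · rw [Polynomial.coeff_eq_zero_of_natDegree_lt, mul_zero]
      exact lt_of_le_of_ne (hmax j (by simp [hj, hcj])) fun h => hji (hdeg h)
  · exact fun h => absurd hi.1 h

section QuasiPolynomialSpace

variable {n : ℕ} {Ni : Fin n → ℕ} {p : ∀ i, Fin (Ni i) → ℂ[X]} {lam : Fin n → ℂ}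

theorem quasiPolynomialSpace_eq_span_range (p : ∀ i, Fin (Ni i) → ℂ[X]) (lam : Fin n → ℂ) :
    quasiPolynomialSpace p lam = Submodule.span ℂ
      (Set.range fun v : Σ i, Fin (Ni i) => quasiPolynomial (p v.1 v.2) (lam v.1)) := by
  unfold quasiPolynomialSpace
  congr 1
  ext g
  constructor
  · rintro ⟨i, j, rfl⟩
    exact ⟨⟨i, j⟩, rfl⟩
  · rintro ⟨⟨i, j⟩, rfl⟩
    exact ⟨i, j, rfl⟩

theorem quasiPolynomial_mem (i : Fin n) (j : Fin (Ni i)) :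
    quasiPolynomial (p i j) (lam i) ∈ quasiPolynomialSpace p lam :=
  Submodule.subset_span ⟨i, j, rfl⟩

theorem quasiPolynomialSpace_le_entireFunctions : quasiPolynomialSpace p lam ≤ entireFunctions := by
  refine Submodule.span_le.2 ?_
  rintro g ⟨i, j, rfl⟩
  exact differentiable_quasiPolynomial (p i j) (lam i)

instance : FiniteDimensional ℂ (quasiPolynomialSpace p lam) := by
  rw [quasiPolynomialSpace_eq_span_range]
  exact FiniteDimensional.span_of_finite ℂ (Set.finite_range _)

theorem finrank_quasiPolynomialSpace (hp : ∀ i j, p i j ≠ 0)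
    (hdeg : ∀ i, Function.Injective fun j => (p i j).natDegree) (hlam : Function.Injective lam) :
    Module.finrank ℂ (quasiPolynomialSpace p lam) = ∑ i, Ni i := by
  have hli : LinearIndependent ℂ
      fun v : Σ i, Fin (Ni i) => quasiPolynomial (p v.1 v.2) (lam v.1) := by
    rw [Fintype.linearIndependent_iff]
    intro g hg
    have h1 : ∀ x, ∑ i, quasiPolynomial (∑ j, g ⟨i, j⟩ • p i j) (lam i) x = 0 := by
      intro x
      have h2 := congrFun hg x
      rw [Fintype.sum_sigma] at h2
      simp only [Finset.sum_apply, Pi.smul_apply, Pi.zero_apply] at h2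
      rw [← h2]
      refine Finset.sum_congr rfl fun i _ => ?_
      simp [quasiPolynomial, Polynomial.eval_finsetSum, Finset.sum_mul, mul_assoc]
    rintro ⟨i, j⟩
    have h3 := eq_zero_of_sum_quasiPolynomial_eq_zero _ lam _ hlam h1 i (Finset.mem_univ i)
    exact Fintype.linearIndependent_iff.1
      (linearIndependent_of_injective_natDegree (hp i) (hdeg i)) _ h3 j
  rw [quasiPolynomialSpace_eq_span_range, finrank_span_eq_card hli]
  simp

/-! ### The primitive operator annihilating a space -/

/-- After cancelling the exponentials, the conditions are `N` linear equations over `ℂ[X]` in `N +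
1` unknowns. -/
theorem exists_annihilates_quasiPolynomialSpace {N : ℕ} (hN : N = ∑ i, Ni i)
    (p : ∀ i, Fin (Ni i) → ℂ[X]) (lam : Fin n → ℂ) :
    ∃ c : Fin (N + 1) → ℂ[X], c ≠ 0 ∧ ∀ f ∈ quasiPolynomialSpace p lam, Annihilates c f := by
  set Q : Matrix (Σ i, Fin (Ni i)) (Fin (N + 1)) ℂ[X] :=
    fun v j => (twistedDerivative (lam v.1) ^ (j : ℕ)) (p v.1 v.2) with hQ
  have hninj : ¬ Function.Injective (Matrix.mulVecLin Q) := by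
    intro hinj
    have := card_le_of_injective ℂ[X] (Matrix.mulVecLin Q) hinj
    simp [← hN] at this
  rw [injective_iff_map_eq_zero] at hninj
  push Not at hninj
  obtain ⟨c, hc, hc0⟩ := hninj
  rw [Matrix.mulVecLin_apply] at hc
  refine ⟨c, hc0, fun f hf => ?_⟩
  refine (annihilates_of_mem_span ?_ hf).2
  rintro g ⟨i, j, rfl⟩
  refine ⟨differentiable_quasiPolynomial (p i j) (lam i), fun x => ?_⟩
  have h1 := congrArg (Polynomial.eval x) (congrFun hc ⟨i, j⟩)
  simp only [Matrix.mulVec, dotProduct, hQ, Polynomial.eval_finsetSum,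
    Polynomial.eval_mul, Pi.zero_apply, Polynomial.eval_zero] at h1
  change ∑ l : Fin (N + 1), (c l).eval x *
    iteratedDeriv (l : ℕ) (quasiPolynomial (p i j) (lam i)) x = 0
  simp only [iteratedDeriv_quasiPolynomial, quasiPolynomial, ← mul_assoc, ← Finset.sum_mul]
  rw [Finset.sum_congr rfl fun l _ => mul_comm _ _, h1, zero_mul]

end QuasiPolynomialSpace

theorem annihilates_of_X_sub_C_mul {N : ℕ} {c : Fin (N + 1) → ℂ[X]} {z : ℂ} {f : ℂ → ℂ}
    (hf : Differentiable ℂ f)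
    (h : Annihilates (fun j => (Polynomial.X - Polynomial.C z) * c j) f) : Annihilates c f := by
  have hoff : ∀ x ≠ z, ∑ j, (c j).eval x * iteratedDeriv (j : ℕ) f x = 0 := by
    intro x hx
    have h1 := h x
    simp only [Polynomial.eval_mul, Polynomial.eval_sub, Polynomial.eval_X, Polynomial.eval_C,
      mul_assoc, ← Finset.mul_sum] at h1
    exact (mul_eq_zero.1 h1).resolve_left (sub_ne_zero.2 hx)
  have hcont : Continuous fun x => ∑ j, (c j).eval x * iteratedDeriv (j : ℕ) f x :=
    continuous_finsetSum _ fun j _ =>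
      (c j).continuous.mul (hf.iteratedDeriv_entire j).continuous
  intro x
  rcases eq_or_ne x z with rfl | hx
  · have h1 : Tendsto (fun x => ∑ j, (c j).eval x * iteratedDeriv (j : ℕ) f x) (𝓝[≠] x)
        (𝓝 (∑ j, (c j).eval x * iteratedDeriv (j : ℕ) f x)) :=
      hcont.continuousAt.tendsto.mono_left inf_le_left
    refine tendsto_nhds_unique h1 (tendsto_const_nhds.congr' ?_)
    filter_upwards [self_mem_nhdsWithin] with y hy using (hoff y hy).symm
  · exact hoff x hx

/-- Take a nonzero annihilating operator whose leading coefficient has least degree. A common zero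
`z` of its coefficients would allow division by `x - z`, which lowers that degree. -/
theorem exists_primitive_operator {N : ℕ} {W : Submodule ℂ (ℂ → ℂ)} (hW : W ≤ entireFunctions)
    [FiniteDimensional ℂ W] (hdim : Module.finrank ℂ W = N)
    (hex : ∃ c : Fin (N + 1) → ℂ[X], c ≠ 0 ∧ ∀ f ∈ W, Annihilates c f) :
    ∃ c : Fin (N + 1) → ℂ[X], (c (Fin.last N)).Monic ∧ (∀ f ∈ W, Annihilates c f) ∧
      ∀ z, ∃ j, (c j).eval z ≠ 0 := by
  classical
  have hex' : ∃ d : ℕ, ∃ c : Fin (N + 1) → ℂ[X], c ≠ 0 ∧ (∀ f ∈ W, Annihilates c f) ∧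
      (c (Fin.last N)).natDegree = d := by
    obtain ⟨c, hc, hcW⟩ := hex
    exact ⟨_, c, hc, hcW, rfl⟩
  obtain ⟨c, hc, hcW, hcd⟩ := Nat.find_spec hex'
  have hlast := last_ne_zero_of_annihilates hW hdim hcW hc
  have hlc := Polynomial.leadingCoeff_ne_zero.2 hlast
  refine ⟨fun j => Polynomial.C (c (Fin.last N)).leadingCoeff⁻¹ * c j, ?_, ?_, ?_⟩
  · dsimp only
    rw [mul_comm]
    exact Polynomial.monic_mul_leadingCoeff_inv hlast
  · intro f hf x
    have h1 := hcW f hf x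
    simp only [Polynomial.eval_mul, Polynomial.eval_C, mul_assoc, ← Finset.mul_sum, h1, mul_zero]
  · intro z
    by_contra! hz
    have hroot : ∀ j, ∃ q, c j = (Polynomial.X - Polynomial.C z) * q := by
      intro j
      have h1 := hz j
      simp only [Polynomial.eval_mul, Polynomial.eval_C, mul_eq_zero, inv_eq_zero, hlc,
        false_or] at h1
      exact Polynomial.dvd_iff_isRoot.2 h1
    choose q hq using hroot
    have hqW : ∀ f ∈ W, Annihilates q f := by
      intro f hf
      refine annihilates_of_X_sub_C_mul (z := z) (hW hf) ?_
      simpa only [← hq] using hcW f hf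
    have hq0 : q ≠ 0 := by
      rintro rfl
      exact hlast (by rw [hq]; simp)
    have hqlast := last_ne_zero_of_annihilates hW hdim hqW hq0
    have hmin := Nat.find_min' hex' ⟨q, hq0, hqW, rfl⟩
    rw [← hcd, hq, Polynomial.natDegree_mul (Polynomial.X_sub_C_ne_zero z) hqlast,
      Polynomial.natDegree_X_sub_C] at hmin
    omega

/-! ### ### The highest power of `x` in the operator -/

section Degree

variable {n : ℕ} {Ni : Fin n → ℕ} {p : ∀ i, Fin (Ni i) → ℂ[X]} {lam : Fin n → ℂ} {N : ℕ}
  {c : Fin (N + 1) → ℂ[X]}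

/-- The set of the degrees of the polynomials `p i j`. -/
def degreeFinset (p : ∀ i, Fin (Ni i) → ℂ[X]) (i : Fin n) : Finset ℕ :=
  Finset.univ.image fun j => (p i j).natDegree

theorem card_degreeFinset {i : Fin n} (hdeg : Function.Injective fun j => (p i j).natDegree) :
    (degreeFinset p i).card = Ni i := by
  rw [degreeFinset, Finset.card_image_of_injective _ hdeg, Finset.card_univ, Fintype.card_fin]

theorem exists_of_mem_degreeFinset (hp : ∀ i j, p i j ≠ 0)
    (hcV : ∀ f ∈ quasiPolynomialSpace p lam, Annihilates c f) (i : Fin n) :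
    ∀ s ∈ degreeFinset p i, ∃ q : ℂ[X], q ≠ 0 ∧ q.natDegree = s ∧
      Annihilates c (quasiPolynomial q (lam i)) := by
  intro s hs
  obtain ⟨j, -, rfl⟩ := Finset.mem_image.1 hs
  exact ⟨p i j, hp i j, rfl, hcV _ (quasiPolynomial_mem i j)⟩

/-- The coefficients of the operator annihilating the space of quasi-polynomials have degree at
most that of the leading one, and the coefficient of the highest power of `x` is
`∏ (∂ - lam i) ^ Ni i`. -/
theorem dualCoeff_natDegree_last (hN : N = ∑ i, Ni i) (hp : ∀ i j, p i j ≠ 0)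
    (hdeg : ∀ i, Function.Injective fun j => (p i j).natDegree) (hlam : Function.Injective lam)
    (hmonic : (c (Fin.last N)).Monic)
    (hcV : ∀ f ∈ quasiPolynomialSpace p lam, Annihilates c f) :
    (∀ i, (c (Fin.last N)).natDegree < i → dualCoeff c i = 0) ∧
      dualCoeff c (c (Fin.last N)).natDegree =
        ∏ i, (Polynomial.X - Polynomial.C (lam i)) ^ Ni i := by
  set K := Finset.univ.sup fun j => (c j).natDegree with hKdef
  have hle : ∀ j, (c j).natDegree ≤ K := fun j =>
    Finset.le_sup (f := fun j => (c j).natDegree) (Finset.mem_univ j)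
  have hK : ∀ i, K < i → dualCoeff c i = 0 := fun i hi =>
    dualCoeff_eq_zero (d := K + 1) (fun j => Nat.lt_succ_of_le (hle j)) hi
  -- The maximal degree `K` is attained. The only way its coefficient could be zero is `K = 0` with
  -- a zero polynomial attaining it, and then the monic leading coefficient is constant and
  -- contributes.
  have hne : dualCoeff c K ≠ 0 := by
    intro h0
    have hcoeff : ∀ j, (c j).coeff K = 0 := by
      intro j; rw [← coeff_dualCoeff, h0, Polynomial.coeff_zero]
    obtain ⟨j, -, hj⟩ := Finset.exists_mem_eq_sup Finset.univ Finset.univ_nonempty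
      fun j => (c j).natDegree
    have hcj : c j = 0 := by
      rw [← Polynomial.leadingCoeff_eq_zero, Polynomial.leadingCoeff, ← hj]
      exact hcoeff j
    have hK0 : K = 0 := by rw [hKdef, hj, hcj, Polynomial.natDegree_zero]
    have h1 : (c (Fin.last N)).natDegree = K := by have := hle (Fin.last N); omega
    have h2 := hmonic.coeff_natDegree
    rw [h1, hcoeff] at h2
    exact zero_ne_one h2
  have hdvd : ∏ i, (Polynomial.X - Polynomial.C (lam i)) ^ Ni i ∣ dualCoeff c K := by
    refine Finset.prod_dvd_of_coprime ?_ fun i _ => ?_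
    · intro i _ j _ hij
      exact (Polynomial.pairwise_coprime_X_sub_C hlam hij).pow
    · have := X_sub_C_pow_dvd_dualCoeff (lam := lam i) hK (exists_of_mem_degreeFinset hp hcV i)
      rwa [card_degreeFinset (hdeg i)] at this
  have hmon : (∏ i, (Polynomial.X - Polynomial.C (lam i)) ^ Ni i).Monic :=
    Polynomial.monic_prod_of_monic _ _ fun i _ => (Polynomial.monic_X_sub_C _).pow _
  have hnat : (∏ i, (Polynomial.X - Polynomial.C (lam i)) ^ Ni i).natDegree = N := by
    rw [Polynomial.natDegree_prod_of_monic _ _ fun i _ => (Polynomial.monic_X_sub_C _).pow _, hN]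
    simp
  -- The order of the operator bounds the degree in `∂` by `N`, and the divisor already has degree
  -- `N`. So `x^K ∂^N` occurs, and the maximal degree is attained by the leading coefficient.
  have hdual : (dualCoeff c K).natDegree = N := by
    refine le_antisymm (Nat.le_of_lt_succ (natDegree_dualCoeff_lt c K)) ?_
    exact hnat.symm.le.trans (Polynomial.natDegree_le_of_dvd hdvd hne)
  have hcoeff : (c (Fin.last N)).coeff K ≠ 0 := by
    have h1 := Polynomial.leadingCoeff_ne_zero.2 hne
    rw [Polynomial.leadingCoeff, hdual] at h1
    rwa [← coeff_dualCoeff, Fin.val_last]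
  have hKeq : (c (Fin.last N)).natDegree = K :=
    le_antisymm (hle _) (Polynomial.le_natDegree_of_ne_zero hcoeff)
  have hdualmonic : (dualCoeff c K).Monic := by
    rw [Polynomial.Monic, Polynomial.leadingCoeff, hdual]
    have := coeff_dualCoeff c K (Fin.last N)
    rw [Fin.val_last] at this
    rw [this, ← hKeq]
    exact hmonic.coeff_natDegree
  rw [hKeq]
  refine ⟨hK, ?_⟩
  exact Polynomial.eq_of_monic_of_dvd_of_natDegree_le hmon hdualmonic hdvd (by rw [hdual, hnat])

theorem coeff_taylor_prod_ne_zero (hlam : Function.Injective lam) (i : Fin n) :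
    (Polynomial.taylor (lam i) (∏ i, (Polynomial.X - Polynomial.C (lam i)) ^ Ni i)).coeff (Ni i) ≠
      0 := by
  classical
  rw [← Finset.mul_prod_erase _ _ (Finset.mem_univ i), Polynomial.taylor_mul,
    Polynomial.taylor_pow]
  simp only [map_sub, Polynomial.taylor_X, Polynomial.taylor_C, add_sub_cancel_right]
  rw [Polynomial.coeff_X_pow_mul', if_pos le_rfl, Nat.sub_self, Polynomial.taylor_coeff_zero,
    Polynomial.eval_prod, Finset.prod_ne_zero_iff]
  intro j hj
  simp only [Polynomial.eval_pow, Polynomial.eval_sub, Polynomial.eval_X, Polynomial.eval_C]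
  exact pow_ne_zero _ (sub_ne_zero.2 fun h => (Finset.ne_of_mem_erase hj) (hlam h).symm)

end Degree

/-! ### Wronskian matrices -/

/-- The matrix whose `i`-th row is `f i, (f i)', …, (f i)^(N-1)`. -/
def wronskianMatrix {N : ℕ} (f : Fin N → ℂ → ℂ) (x : ℂ) : Matrix (Fin N) (Fin N) ℂ :=
  Matrix.of fun i l => iteratedDeriv (l : ℕ) (f i) x

theorem Wronskian_eq_det {N : ℕ} (f : Fin N → ℂ → ℂ) (x : ℂ) :
    Wronskian f x = (wronskianMatrix f x).det := rfl

theorem eventually_nhdsNE_of_codiscrete {P : ℂ → Prop} (h : ∀ᶠ x in codiscrete ℂ, P x) (z : ℂ) :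
    ∀ᶠ x in 𝓝[≠] z, P x := by
  have := mem_codiscrete.1 h z
  rwa [disjoint_principal_right, compl_compl] at this

theorem eventually_codiscrete_notMem {s : Set ℂ} (hs : s.Finite) :
    ∀ᶠ x in codiscrete ℂ, x ∉ s :=
  compl_finite_mem_codiscreteWithin hs

section Basis

variable {N : ℕ} {W : Submodule ℂ (ℂ → ℂ)}

theorem iteratedDeriv_coe_sum_smul (hW : W ≤ entireFunctions) {ι : Type*} (t : Finset ι)
    (v : ι → ℂ) (b : ι → W) (l : ℕ) (x : ℂ) :
    iteratedDeriv l ((∑ i ∈ t, v i • b i : W) : ℂ → ℂ) x =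
      ∑ i ∈ t, v i * iteratedDeriv l (b i : ℂ → ℂ) x := by
  rw [← iteratedDeriv_sum_entire t v (fun i => (b i : ℂ → ℂ)) (fun i => hW (b i).2)]
  simp

/-- A left kernel vector would give a nonzero element of `W` of order at least `N` at `x`, while the
exponents at a nonsingular point stop at `N - 1`. -/
theorem det_wronskianMatrix_ne_zero (hW : W ≤ entireFunctions)
    (b : Module.Basis (Fin N) ℂ W) {x : ℂ} (hx : x ∉ singularPoints W) :
    (wronskianMatrix (fun i => (b i : ℂ → ℂ)) x).det ≠ 0 := by
  have hdim : Module.finrank ℂ W = N := by simp [Module.finrank_eq_card_basis b]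
  intro hdet
  obtain ⟨v, hv, hvF⟩ := Matrix.exists_vecMul_eq_zero_iff.2 hdet
  set f : W := ∑ i, v i • b i with hf
  have hf0 : f ≠ 0 := by
    intro h0
    apply hv
    funext i
    exact Fintype.linearIndependent_iff.1 b.linearIndependent v h0 i
  have hvan : ∀ l < N, iteratedDeriv l (f : ℂ → ℂ) x = 0 := by
    intro l hl
    have h1 := congrFun hvF ⟨l, hl⟩
    rw [hf, iteratedDeriv_coe_sum_smul hW]
    simpa [Matrix.vecMul, dotProduct, wronskianMatrix] using h1
  obtain ⟨s, hs⟩ := exists_meromorphicOrderAt_eq (hW f.2) (fun h => hf0 (Subtype.ext h)) x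
  have hmem : (s : ℤ) ∈ exponents W x := ⟨f, f.2, hs⟩
  have hexp : exponents W x = Set.Ico (0 : ℤ) (Module.finrank ℂ W) := by
    by_contra h; exact hx h
  rw [hexp, hdim] at hmem
  exact ((meromorphicOrderAt_eq_iff_iteratedDeriv (hW f.2) x s).1 hs).2
    (hvan s (by exact_mod_cast hmem.2))

end Basis

/-! ### Regularized fundamental operators -/

section Fundamental

variable {N : ℕ} {W : Submodule ℂ (ℂ → ℂ)} {c : Fin (N + 1) → ℂ[X]}

/-- The operator `∑ c j ∂ ^ j` is monic up to normalization, annihilates the space `W` of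
dimension `N`, has no common zero of the coefficients, and is singular exactly at the singular
points of `W`. -/
structure IsPrimitiveOperator (N : ℕ) (W : Submodule ℂ (ℂ → ℂ)) (c : Fin (N + 1) → ℂ[X]) :
    Prop where
  entire : W ≤ entireFunctions
  dim : Module.finrank ℂ W = N
  finite : FiniteDimensional ℂ W
  monic : (c (Fin.last N)).Monic
  annihilates : ∀ f ∈ W, Annihilates c f
  primitive : ∀ z, ∃ j, (c j).eval z ≠ 0
  singular : ∀ z, z ∈ singularPoints W ↔ (c (Fin.last N)).eval z = 0

namespace IsPrimitiveOperator

theorem singularPoints_eq (h : IsPrimitiveOperator N W c) :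
    singularPoints W = ((c (Fin.last N)).roots.toFinset : Set ℂ) := by
  ext z
  simp [h.singular, h.monic.ne_zero]

theorem finite_singularPoints (h : IsPrimitiveOperator N W c) : (singularPoints W).Finite := by
  rw [h.singularPoints_eq]
  exact Finset.finite_toSet _

/-- Two monic operators of order `N` differ by one of lower order; its coefficients at `x` lie in
the kernel of the Wronskian matrix, which is invertible off the singular points. -/
theorem eventually_eq_div (h : IsPrimitiveOperator N W c) {A : Fin (N + 1) → ℂ → ℂ}
    (hA : IsMonicFundamentalOperator N W A) :
    ∀ᶠ x in codiscrete ℂ, (c (Fin.last N)).eval x ≠ 0 ∧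
      ∀ j, A j x = (c j).eval x / (c (Fin.last N)).eval x := by
  have := h.finite
  set b : Module.Basis (Fin N) ℂ W := Module.finBasisOfFinrankEq ℂ W h.dim
  have h1 : ∀ᶠ x in codiscrete ℂ, ∀ i, ∑ j : Fin (N + 1), A j x *
      iteratedDeriv (j : ℕ) (b i : ℂ → ℂ) x = 0 :=
    eventually_all.2 fun i => hA.annihilates _ (b i).2
  filter_upwards [h1, eventually_codiscrete_notMem h.finite_singularPoints] with x hx hsing
  have hlast : (c (Fin.last N)).eval x ≠ 0 := (h.singular x).not.1 hsing
  refine ⟨hlast, ?_⟩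
  set a : Fin N → ℂ := fun j => A j.castSucc x -
    (c j.castSucc).eval x / (c (Fin.last N)).eval x with ha
  have hmul : (wronskianMatrix (fun i => (b i : ℂ → ℂ)) x).mulVec a = 0 := by
    funext i
    have h2 := hx i
    have h3 := h.annihilates _ (b i).2 x
    rw [Fin.sum_univ_castSucc] at h2 h3
    rw [hA.monic, one_mul, Fin.val_last] at h2
    rw [Fin.val_last] at h3
    simp only [Matrix.mulVec, dotProduct, wronskianMatrix, Matrix.of_apply, ha, Pi.zero_apply,
      mul_sub, Finset.sum_sub_distrib]
    simp only [Fin.val_castSucc] at h2 h3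
    have h4 : ∑ l : Fin N, iteratedDeriv (l : ℕ) (b i : ℂ → ℂ) x *
        ((c l.castSucc).eval x / (c (Fin.last N)).eval x) =
        (∑ l : Fin N, (c l.castSucc).eval x * iteratedDeriv (l : ℕ) (b i : ℂ → ℂ) x) /
          (c (Fin.last N)).eval x := by
      rw [Finset.sum_div]
      exact Finset.sum_congr rfl fun l _ => by ring
    have h5 : ∑ l : Fin N, iteratedDeriv (l : ℕ) (b i : ℂ → ℂ) x * A l.castSucc x =
        ∑ l : Fin N, A l.castSucc x * iteratedDeriv (l : ℕ) (b i : ℂ → ℂ) x :=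
      Finset.sum_congr rfl fun l _ => mul_comm _ _
    rw [h4, h5, eq_neg_of_add_eq_zero_left h2, eq_neg_of_add_eq_zero_left h3]
    field_simp
    ring
  have ha0 : a = 0 := by
    by_contra hne
    exact det_wronskianMatrix_ne_zero h.entire b hsing
      (Matrix.exists_mulVec_eq_zero_iff.1 ⟨a, hne, hmul⟩)
  intro j
  refine Fin.lastCases ?_ (fun j => ?_) j
  · rw [hA.monic, div_self hlast]
  · exact sub_eq_zero.1 (congrFun ha0 j)

theorem exists_isMonicFundamentalOperator (h : IsPrimitiveOperator N W c) :
    ∃ A, IsMonicFundamentalOperator N W A := by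
  refine ⟨fun j x => if j = Fin.last N then 1 else (c j).eval x / (c (Fin.last N)).eval x,
    h.dim, fun j z => ?_, fun x => by simp, fun f hf => ?_⟩
  · by_cases hj : j = Fin.last N
    · simp only [hj, if_true]
      exact analyticAt_const.meromorphicAt
    · simp only [hj, if_false]
      have h1 : ∀ q : ℂ[X], MeromorphicAt (fun x => q.eval x) z := fun q =>
        (q.differentiable.analyticAt z).meromorphicAt
      exact (h1 _).div (h1 _)
  · filter_upwards [eventually_codiscrete_notMem h.finite_singularPoints] with x hsing
    have hlast : (c (Fin.last N)).eval x ≠ 0 := (h.singular x).not.1 hsing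
    have h1 : ∀ j, (if j = Fin.last N then 1 else (c j).eval x / (c (Fin.last N)).eval x) =
        (c j).eval x / (c (Fin.last N)).eval x := by
      intro j
      split_ifs with hj
      · rw [hj, div_self hlast]
      · rfl
    simp only [h1, div_mul_eq_mul_div, ← Finset.sum_div, h.annihilates f hf x, Pi.zero_apply,
      zero_div]

/-- With `q` the leading coefficient freed of its zero at `z`, of order `μ`, the coefficients of `(x
- z)^k` times the monic operator are `(x - z)^(k - μ) * c j / q`. By primitivity some `c j` is
nonzero at `z`, so the absence of poles means exactly `μ ≤ k`. -/
theorem poleOrder_eq (h : IsPrimitiveOperator N W c) (z : ℂ) :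
    poleOrder W z = (c (Fin.last N)).rootMultiplicity z := by
  obtain rfl := h.dim
  obtain ⟨q, hq, hqz⟩ := Polynomial.exists_eq_pow_rootMultiplicity_mul_and_not_dvd
    (c (Fin.last _)) h.monic.ne_zero z
  set μ := (c (Fin.last _)).rootMultiplicity z with hμ
  rw [Polynomial.dvd_iff_isRoot, Polynomial.IsRoot] at hqz
  have hanalytic : ∀ j, AnalyticAt ℂ (fun x => (c j).eval x / q.eval x) z := fun j =>
    ((c j).differentiable.analyticAt z).div (q.differentiable.analyticAt z) hqz
  have hev : ∀ {A : Fin (Module.finrank ℂ W + 1) → ℂ → ℂ},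
      IsMonicFundamentalOperator (Module.finrank ℂ W) W A → ∀ (k : ℕ) j,
      ∀ᶠ x in 𝓝[≠] z, (x - z) ^ k * A j x =
        (x - z) ^ ((k : ℤ) - μ) • ((c j).eval x / q.eval x) := by
    intro A hA k j
    filter_upwards [eventually_nhdsNE_of_codiscrete (h.eventually_eq_div hA) z,
      self_mem_nhdsWithin] with x hx hxz
    have h1 : x - z ≠ 0 := sub_ne_zero.2 hxz
    have hc : (c (Fin.last _)).eval x = (x - z) ^ μ * q.eval x := by
      conv_lhs => rw [hq]
      simp
    have h2 : q.eval x ≠ 0 := fun h0 => hx.1 (by rw [hc, h0, mul_zero])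
    rw [hx.2 j, hc, zpow_sub₀ h1, zpow_natCast, zpow_natCast, smul_eq_mul]
    field_simp
  have hmero : ∀ {A : Fin (Module.finrank ℂ W + 1) → ℂ → ℂ},
      IsMonicFundamentalOperator (Module.finrank ℂ W) W A → ∀ (k : ℕ) j,
      MeromorphicAt (fun x => (x - z) ^ k * A j x) z := by
    intro A hA k j
    exact (MeromorphicAt.pow (by fun_prop) k).mul (hA.meromorphic j z)
  refine le_antisymm (Nat.sInf_le ?_) (le_csInf ?_ ?_)
  · obtain ⟨A, hA⟩ := h.exists_isMonicFundamentalOperator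
    refine ⟨A, hA, fun j => ?_⟩
    have h1 : (fun x => (x - z) ^ μ * A j x) =ᶠ[𝓝[≠] z] fun x => (c j).eval x / q.eval x := by
      filter_upwards [hev hA μ j] with x hx
      rw [hx]; simp
    rw [meromorphicOrderAt_congr h1]
    exact (hanalytic j).meromorphicOrderAt_nonneg
  · obtain ⟨A, hA⟩ := h.exists_isMonicFundamentalOperator
    refine ⟨μ, A, hA, fun j => ?_⟩
    have h1 : (fun x => (x - z) ^ μ * A j x) =ᶠ[𝓝[≠] z] fun x => (c j).eval x / q.eval x := by
      filter_upwards [hev hA μ j] with x hx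
      rw [hx]; simp
    rw [meromorphicOrderAt_congr h1]
    exact (hanalytic j).meromorphicOrderAt_nonneg
  · rintro k ⟨A, hA, hk⟩
    obtain ⟨j, hj⟩ := h.primitive z
    have h1 : meromorphicOrderAt (fun x => (x - z) ^ k * A j x) z =
        (((k : ℤ) - μ : ℤ) : WithTop ℤ) :=
      (meromorphicOrderAt_eq_int_iff (hmero hA k j)).2
        ⟨_, hanalytic j, div_ne_zero hj hqz, hev hA k j⟩
    have h2 := hk j
    rw [h1] at h2
    have h3 : (0 : ℤ) ≤ (k : ℤ) - μ := by exact_mod_cast h2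
    omega

theorem regularizingFactor_eq (h : IsPrimitiveOperator N W c) (x : ℂ) :
    regularizingFactor W x = (c (Fin.last N)).eval x := by
  classical
  unfold regularizingFactor
  rw [h.singularPoints_eq, finprod_mem_coe_finset]
  have h1 := Polynomial.prod_multiset_X_sub_C_of_monic_of_roots_card_eq h.monic
    (IsAlgClosed.card_roots_eq_natDegree)
  conv_rhs => rw [← h1, Finset.prod_multiset_map_count, Polynomial.eval_prod]
  refine Finset.prod_congr rfl fun z _ => ?_
  simp [h.poleOrder_eq]

/-- A primitive operator is the regularized fundamental operator. -/
theorem isRegularizedFundamentalOperator (h : IsPrimitiveOperator N W c) :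
    IsRegularizedFundamentalOperator N W fun j x => (c j).eval x := by
  obtain ⟨A, hA⟩ := h.exists_isMonicFundamentalOperator
  refine ⟨h.finite_singularPoints, A, hA, fun j => ⟨(c j).differentiable, ?_⟩⟩
  filter_upwards [h.eventually_eq_div hA] with x hx
  rw [h.regularizingFactor_eq, hx.2 j, mul_div_cancel₀ _ hx.1]

/-- Polynomials that agree off a discrete set are equal. This uniqueness lets (iii) be proved for
every matrix of coefficients. -/
theorem eq_of_isRegularizedFundamentalOperator (h : IsPrimitiveOperator N W c)
    {d : Fin (N + 1) → ℂ[X]}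
    (hd : IsRegularizedFundamentalOperator N W fun j x => (d j).eval x) : d = c := by
  obtain ⟨-, A, hA, hdA⟩ := hd
  funext j
  have h1 : ∀ᶠ x in codiscrete ℂ, (d j).eval x = (c j).eval x := by
    filter_upwards [h.eventually_eq_div hA, (hdA j).2] with x hx hdx
    rw [hdx, h.regularizingFactor_eq, hx.2 j, mul_div_cancel₀ _ hx.1]
  refine Polynomial.eq_of_infinite_eval_eq _ _ fun hfin => ?_
  obtain ⟨x, hx, hx'⟩ := ((eventually_nhdsNE_of_codiscrete h1 0).and
    (eventually_nhdsNE_of_codiscrete (eventually_codiscrete_notMem hfin) 0)).exists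
  exact hx' hx

end IsPrimitiveOperator

end Fundamental

/-! ### The conjugate space -/

theorem differentiable_det {ι : Type*} [Fintype ι] [DecidableEq ι] {A : ℂ → Matrix ι ι ℂ}
    (hA : ∀ i j, Differentiable ℂ fun x => A x i j) : Differentiable ℂ fun x => (A x).det := by
  simp only [Matrix.det_apply]
  refine Differentiable.fun_sum fun σ _ => ?_
  exact (Differentiable.fun_finsetProd fun i _ => hA _ _).const_smul _

theorem differentiableAt_inv_apply {ι : Type*} [Fintype ι] [DecidableEq ι] {A : ℂ → Matrix ι ι ℂ}
    (hA : ∀ i j, Differentiable ℂ fun x => A x i j) {x : ℂ} (hx : (A x).det ≠ 0) (i j : ι) :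
    DifferentiableAt ℂ (fun y => (A y)⁻¹ i j) x := by
  simp only [Matrix.inv_def, Matrix.smul_apply, Ring.inverse_eq_inv', smul_eq_mul,
    Matrix.adjugate_apply]
  refine ((differentiable_det hA x).inv hx).mul (differentiable_det (fun k l => ?_) x)
  simp only [Matrix.updateRow_apply]
  split_ifs
  · exact differentiable_const _
  · exact hA k l

theorem eq_inv_apply_of_vecMul_eq_single {ι : Type*} [Fintype ι] [DecidableEq ι]
    {F : Matrix ι ι ℂ} (hF : F.det ≠ 0) {t : ι → ℂ} {a : ℂ} {l : ι}
    (ht : Matrix.vecMul t F = Pi.single l a) (i : ι) : t i = a * F⁻¹ l i := by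
  have hu : IsUnit F.det := isUnit_iff_ne_zero.2 hF
  have h1 : Matrix.vecMul (Matrix.vecMul t F) F⁻¹ = t := by
    rw [Matrix.vecMul_vecMul, Matrix.mul_nonsing_inv _ hu, Matrix.vecMul_one]
  rw [← h1, ht, Matrix.single_vecMul]
  simp

/-- The functions `g 0, …, g N` such that `∑ g i (f i)^(l)` is `0` for `l < N` and `1` for
`l = N`. -/
def conjugateFunction {N : ℕ} (f : Fin (N + 1) → ℂ → ℂ) (i : Fin (N + 1)) (x : ℂ) : ℂ :=
  (wronskianMatrix f x)⁻¹ (Fin.last N) i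

section Conjugate

variable {N : ℕ} {W : Submodule ℂ (ℂ → ℂ)}

theorem wronskianMatrix_eq_mul (hW : W ≤ entireFunctions) (b : Module.Basis (Fin N) ℂ W)
    (w : Fin N → W) (x : ℂ) :
    wronskianMatrix (fun i => (w i : ℂ → ℂ)) x =
      (b.toMatrix w).transpose * wronskianMatrix (fun i => (b i : ℂ → ℂ)) x := by
  ext i l
  simp only [wronskianMatrix, Matrix.mul_apply, Matrix.transpose_apply, Matrix.of_apply,
    Module.Basis.toMatrix_apply]
  conv_lhs => rw [← b.sum_repr (w i)]
  exact iteratedDeriv_coe_sum_smul hW _ _ _ _ _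

theorem det_wronskianMatrix_eq_mul (hW : W ≤ entireFunctions) (b : Module.Basis (Fin N) ℂ W)
    (w : Fin N → W) (x : ℂ) :
    (wronskianMatrix (fun i => (w i : ℂ → ℂ)) x).det =
      b.det w * (wronskianMatrix (fun i => (b i : ℂ → ℂ)) x).det := by
  rw [wronskianMatrix_eq_mul hW b, Matrix.det_mul, Matrix.det_transpose, Module.Basis.det_apply]

theorem det_wronskianMatrix_of_last_row {f : Fin (N + 1) → ℂ → ℂ} {x : ℂ}
    (hlast : ∀ l : Fin (N + 1), iteratedDeriv (l : ℕ) (f (Fin.last N)) x =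
      if l = Fin.last N then 1 else 0) :
    (wronskianMatrix f x).det = Wronskian (fun i : Fin N => f i.castSucc) x := by
  rw [Matrix.det_succ_row _ (Fin.last N), Finset.sum_eq_single (Fin.last N)]
  · have h1 : wronskianMatrix f x (Fin.last N) (Fin.last N) = 1 := by
      simpa [wronskianMatrix] using hlast (Fin.last N)
    rw [h1, Even.neg_one_pow ⟨_, rfl⟩, one_mul, one_mul, Wronskian_eq_det]
    congr 1
    ext i l
    simp [wronskianMatrix]
  · intro l _ hl
    have h1 : wronskianMatrix f x (Fin.last N) l = 0 := by
      simpa [wronskianMatrix, hl] using hlast l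
    rw [h1]; simp
  · simp

/-- For fixed `x`, the combination `v` of the `b i` with the constants `conjugateFunction _ i x` has
derivatives `0, …, 0, 1` at `x`. Hence the Wronskian of `f` followed by `v` reduces at `x` to that
of `f`. It is also `b'.det` of these vectors times the Wronskian of `b'`, and `b'.det` is linear in
`v`. -/
theorem Wronskian_div_eq_sum (hW : W ≤ entireFunctions) (b b' : Module.Basis (Fin (N + 1)) ℂ W)
    (f : Fin N → W) (x : ℂ) :
    Wronskian (fun i => (f i : ℂ → ℂ)) x / Wronskian (fun i => (b' i : ℂ → ℂ)) x =
      ∑ i, b'.det (Fin.snoc f (b i) : Fin (N + 1) → W) *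
        conjugateFunction (fun i => (b i : ℂ → ℂ)) i x := by
  set F := wronskianMatrix (fun i => (b i : ℂ → ℂ)) x with hF
  have hdet : Wronskian (fun i => (b' i : ℂ → ℂ)) x = b.det b' * F.det := by
    rw [Wronskian_eq_det, det_wronskianMatrix_eq_mul hW b]
  by_cases hF0 : F.det = 0
  -- Where the Wronskian vanishes, both sides are zero by the conventions for division and for
  -- inverses of singular matrices.
  · rw [hdet, hF0, mul_zero, div_zero, Finset.sum_eq_zero]
    intro i _
    rw [conjugateFunction, ← hF, Matrix.nonsing_inv_apply_not_isUnit _ (by simp [hF0])]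
    simp
  · have hu : IsUnit F.det := isUnit_iff_ne_zero.2 hF0
    set v : W := ∑ i, conjugateFunction (fun i => (b i : ℂ → ℂ)) i x • b i with hv
    have hjet : ∀ l : Fin (N + 1), iteratedDeriv (l : ℕ) (v : ℂ → ℂ) x =
        if l = Fin.last N then 1 else 0 := by
      intro l
      rw [hv, iteratedDeriv_coe_sum_smul hW]
      have h1 := congrFun (congrFun (Matrix.nonsing_inv_mul F hu) (Fin.last N)) l
      rw [Matrix.mul_apply, Matrix.one_apply] at h1
      simp only [eq_comm (a := l)]
      exact h1
    have h1 := det_wronskianMatrix_of_last_row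
      (f := fun i => ((Fin.snoc f v : Fin (N + 1) → W) i : ℂ → ℂ)) (x := x)
      (fun l => by simpa using hjet l)
    simp only [Fin.snoc_castSucc] at h1
    rw [det_wronskianMatrix_eq_mul hW b'] at h1
    have h2 : Wronskian (fun i => (b' i : ℂ → ℂ)) x ≠ 0 := by
      rw [hdet]
      exact mul_ne_zero (b.isUnit_det b').ne_zero hF0
    rw [← h1, ← Wronskian_eq_det, mul_div_cancel_right₀ _ h2]
    have h3 : ∀ w : W, b'.det (Fin.snoc f w : Fin (N + 1) → W) =
        b'.det.toMultilinearMap.toLinearMap (Fin.snoc f 0 : Fin (N + 1) → W) (Fin.last N) w := by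
      intro w
      rw [MultilinearMap.toLinearMap_apply, Fin.update_snoc_last]
      rfl
    simp only [h3]
    rw [hv, map_sum]
    exact Finset.sum_congr rfl fun i _ => by rw [map_smul, smul_eq_mul, mul_comm]

/-- One inclusion is `Wronskian_div_eq_sum`. The other is Cramer's rule: the minors giving the last
row of the inverse are Wronskians of the basis with one function removed. -/
theorem conjugateSpace_eq_span (hW : W ≤ entireFunctions) (b : Module.Basis (Fin (N + 1)) ℂ W) :
    conjugateSpace W = Submodule.span ℂ
      (Set.range (conjugateFunction fun i => (b i : ℂ → ℂ))) := by
  have hdim : Module.finrank ℂ W = N + 1 := by simp [Module.finrank_eq_card_basis b]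
  -- The dimension is made a variable so that `N + 1` can replace it inside the index types.
  have h1 : ∀ d, Module.finrank ℂ W = d → conjugateSpace W = Submodule.span ℂ
      {g | ∃ (b : Module.Basis (Fin d) ℂ W) (f : Fin (d - 1) → W), g = fun x =>
        Wronskian (fun i => (f i : ℂ → ℂ)) x / Wronskian (fun i => (b i : ℂ → ℂ)) x} := by
    rintro d rfl; rfl
  rw [h1 _ hdim]
  apply le_antisymm
  · refine Submodule.span_le.2 ?_
    rintro g ⟨b', f, rfl⟩
    have h2 : (fun x => Wronskian (fun i => (f i : ℂ → ℂ)) x /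
        Wronskian (fun i => (b' i : ℂ → ℂ)) x) = ∑ i,
        b'.det (Fin.snoc (α := fun _ => W) (n := N) f (b i) : Fin (N + 1) → W) •
          conjugateFunction (fun i => (b i : ℂ → ℂ)) i := by
      funext x
      rw [Finset.sum_apply]
      exact Wronskian_div_eq_sum hW b b' f x
    rw [SetLike.mem_coe, h2]
    exact Submodule.sum_mem _ fun i _ => Submodule.smul_mem _ _ (Submodule.subset_span ⟨i, rfl⟩)
  · refine Submodule.span_le.2 ?_
    rintro g ⟨i, rfl⟩
    have h2 : conjugateFunction (fun i => (b i : ℂ → ℂ)) i = ((-1 : ℂ) ^ ((i : ℕ) + N)) •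
        fun x => Wronskian (fun k : Fin N => ((b (i.succAbove k) : W) : ℂ → ℂ)) x /
          Wronskian (fun i => (b i : ℂ → ℂ)) x := by
      funext x
      rw [conjugateFunction, Matrix.inv_def, Matrix.smul_apply,
        Matrix.adjugate_fin_succ_eq_det_submatrix, Pi.smul_apply, Ring.inverse_eq_inv',
        Wronskian_eq_det, Wronskian_eq_det, smul_eq_mul, smul_eq_mul, Fin.val_last]
      have h3 : (wronskianMatrix (fun i => (b i : ℂ → ℂ)) x).submatrix i.succAbove
          (Fin.last N).succAbove =
          wronskianMatrix (fun k : Fin N => ((b (i.succAbove k) : W) : ℂ → ℂ)) x := by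
        ext k l
        simp [wronskianMatrix]
      rw [h3]
      ring
    rw [SetLike.mem_coe, h2]
    exact Submodule.smul_mem _ _ (Submodule.subset_span ⟨b, fun k => b (i.succAbove k), rfl⟩)

theorem regularizedConjugateSpace_eq_span (hW : W ≤ entireFunctions)
    (b : Module.Basis (Fin (N + 1)) ℂ W) :
    regularizedConjugateSpace W = Submodule.span ℂ (Set.range fun i x =>
      conjugateFunction (fun i => (b i : ℂ → ℂ)) i x * (regularizingFactor W x)⁻¹) := by
  unfold regularizedConjugateSpace
  rw [conjugateSpace_eq_span hW b]
  apply le_antisymm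
  · refine Submodule.span_le.2 ?_
    rintro g ⟨f, hf, rfl⟩
    obtain ⟨a, rfl⟩ := (Submodule.mem_span_range_iff_exists_fun ℂ).1 hf
    rw [SetLike.mem_coe, Submodule.mem_span_range_iff_exists_fun]
    refine ⟨a, ?_⟩
    funext x
    simp [Finset.sum_mul, mul_assoc]
  · refine Submodule.span_le.2 ?_
    rintro g ⟨i, rfl⟩
    exact Submodule.subset_span ⟨_, Submodule.subset_span ⟨i, rfl⟩, rfl⟩

end Conjugate

/-! ### Variation of parameters -/

section Variation

variable {N : ℕ} {W : Submodule ℂ (ℂ → ℂ)} {c : Fin (N + 1 + 1) → ℂ[X]}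

theorem differentiable_wronskianMatrix_apply {f : Fin N → ℂ → ℂ} (hf : ∀ i, Differentiable ℂ (f i))
    (i l : Fin N) : Differentiable ℂ fun x => wronskianMatrix f x i l :=
  (hf i).iteratedDeriv_entire l

/-- Variation of parameters: `H` expresses the derivatives of `h` of order at most `N` through those
of the `f k`. Differentiating these relations determines the derivatives of the `H k`, which see `h`
only through the operator applied to it. -/
theorem exists_hasDerivAt_variation {f : Fin (N + 1) → ℂ → ℂ} (hf : ∀ i, Differentiable ℂ (f i))
    (hcf : ∀ i, Annihilates c (f i)) {h : ℂ → ℂ} (hh : Differentiable ℂ h) (i : Fin (N + 1)) :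
    ∃ H : ℂ → ℂ, ∀ x, (wronskianMatrix f x).det ≠ 0 → (c (Fin.last (N + 1))).eval x ≠ 0 →
      HasDerivAt H ((∑ j, (c j).eval x * iteratedDeriv (j : ℕ) h x) /
        (c (Fin.last (N + 1))).eval x * conjugateFunction f i x) x := by
  set H : Fin (N + 1) → ℂ → ℂ := fun i x =>
    ∑ l : Fin (N + 1), iteratedDeriv (l : ℕ) h x * (wronskianMatrix f x)⁻¹ l i with hH
  refine ⟨H i, fun x hdet hc => ?_⟩
  have hent := differentiable_wronskianMatrix_apply hf
  have hdiff : ∀ k, DifferentiableAt ℂ (H k) x := fun k =>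
    DifferentiableAt.fun_sum fun l _ =>
      (hh.iteratedDeriv_entire l x).mul (differentiableAt_inv_apply hent hdet l k)
  have hsol : ∀ y, (wronskianMatrix f y).det ≠ 0 → ∀ l : Fin (N + 1),
      ∑ k, H k y * iteratedDeriv (l : ℕ) (f k) y = iteratedDeriv (l : ℕ) h y := by
    intro y hy l
    have hu := isUnit_iff_ne_zero.2 hy
    have h1 : Matrix.vecMul (Matrix.vecMul (fun l : Fin (N + 1) => iteratedDeriv (l : ℕ) h y)
        (wronskianMatrix f y)⁻¹) (wronskianMatrix f y) =
        fun l : Fin (N + 1) => iteratedDeriv (l : ℕ) h y := by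
      rw [Matrix.vecMul_vecMul, Matrix.nonsing_inv_mul _ hu, Matrix.vecMul_one]
    exact congrFun h1 l
  have hev : ∀ᶠ y in 𝓝 x, (wronskianMatrix f y).det ≠ 0 :=
    (differentiable_det hent).continuous.continuousAt.eventually_ne hdet
  have hder : ∀ l : Fin (N + 1), ∑ k, (deriv (H k) x * iteratedDeriv (l : ℕ) (f k) x +
      H k x * iteratedDeriv ((l : ℕ) + 1) (f k) x) = iteratedDeriv ((l : ℕ) + 1) h x := by
    intro l
    have h1 : HasDerivAt (fun y => ∑ k, H k y * iteratedDeriv (l : ℕ) (f k) y)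
        (∑ k, (deriv (H k) x * iteratedDeriv (l : ℕ) (f k) x +
          H k x * iteratedDeriv ((l : ℕ) + 1) (f k) x)) x := by
      refine HasDerivAt.fun_sum fun k _ => (hdiff k).hasDerivAt.mul ?_
      rw [iteratedDeriv_succ]
      exact ((hf k).iteratedDeriv_entire l x).hasDerivAt
    have h2 : (fun y => ∑ k, H k y * iteratedDeriv (l : ℕ) (f k) y) =ᶠ[𝓝 x]
        iteratedDeriv (l : ℕ) h := by
      filter_upwards [hev] with y hy using hsol y hy l
    rw [← h1.deriv, h2.deriv_eq, iteratedDeriv_succ]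
  -- For `l < N` the next relation cancels everything but the derivatives of `H`. For `l = N` the
  -- equations satisfied by the `f k` remove the lower terms and leave the operator applied to `h`.
  have hvec : Matrix.vecMul (fun k => deriv (H k) x) (wronskianMatrix f x) =
      Pi.single (Fin.last N) ((∑ j, (c j).eval x * iteratedDeriv (j : ℕ) h x) /
        (c (Fin.last (N + 1))).eval x) := by
    funext l
    have h1 := hder l
    rw [Finset.sum_add_distrib] at h1
    change ∑ k, deriv (H k) x * iteratedDeriv (l : ℕ) (f k) x = _
    by_cases hl : l = Fin.last N
    · subst hl
      rw [Pi.single_eq_same, eq_div_iff hc,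
        Fin.sum_univ_castSucc fun j : Fin (N + 1 + 1) => (c j).eval x * iteratedDeriv (j : ℕ) h x]
      have h2 : ∑ k, H k x * ∑ j : Fin (N + 1 + 1), (c j).eval x *
          iteratedDeriv (j : ℕ) (f k) x = 0 :=
        Finset.sum_eq_zero fun k _ => by rw [hcf k x, mul_zero]
      simp only [Finset.mul_sum] at h2
      rw [Finset.sum_comm, Fin.sum_univ_castSucc] at h2
      have h3 : ∀ j : Fin (N + 1), ∑ k, H k x * ((c j.castSucc).eval x *
          iteratedDeriv (j.castSucc : ℕ) (f k) x) =
          (c j.castSucc).eval x * iteratedDeriv (j.castSucc : ℕ) h x := by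
        intro j
        rw [Fin.val_castSucc, ← hsol x hdet j, Finset.mul_sum]
        exact Finset.sum_congr rfl fun k _ => by ring
      have h4 : ∑ k, H k x * ((c (Fin.last (N + 1))).eval x *
          iteratedDeriv (Fin.last (N + 1) : ℕ) (f k) x) = (c (Fin.last (N + 1))).eval x *
          ∑ k, H k x * iteratedDeriv ((Fin.last N : ℕ) + 1) (f k) x := by
        rw [Finset.mul_sum]
        exact Finset.sum_congr rfl fun k _ => by simp only [Fin.val_last]; ring
      rw [Finset.sum_congr rfl fun j _ => h3 j, h4] at h2
      have h5 : iteratedDeriv (Fin.last (N + 1) : ℕ) h x =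
          iteratedDeriv ((Fin.last N : ℕ) + 1) h x := rfl
      rw [h5, ← h1]
      linear_combination -h2
    · rw [Pi.single_eq_of_ne hl]
      have hlt : (l : ℕ) + 1 < N + 1 := by
        have := Fin.val_lt_last hl
        omega
      have h2 := hsol x hdet ⟨(l : ℕ) + 1, hlt⟩
      simp only at h2
      rw [h2] at h1
      exact add_eq_right.1 h1
  have := eq_inv_apply_of_vecMul_eq_single hdet hvec i
  rw [conjugateFunction, ← this]
  exact (hdiff i).hasDerivAt

end Variation

/-! ### Local form of the conjugate functions -/

section LocalForm

variable {N : ℕ} {f : Fin (N + 1) → ℂ → ℂ} {z : ℂ} {e : Fin (N + 1) → ℕ}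

/-- If `f i` has order `e i` at `z`, then the `i`-th conjugate function has order `N - e i`. -/
theorem exists_conjugateFunction_eq_zpow_mul (hf : ∀ i, Differentiable ℂ (f i))
    (he : Function.Injective e)
    (hord : ∀ i, meromorphicOrderAt (f i) z = ((e i : ℤ) : WithTop ℤ)) (i : Fin (N + 1)) :
    ∃ w : ℂ → ℂ, w z ≠ 0 ∧ DifferentiableAt ℂ w z ∧
      ∀ x ≠ z, (wronskianMatrix f x).det ≠ 0 → DifferentiableAt ℂ w x ∧
        conjugateFunction f i x = (x - z) ^ ((N : ℤ) - e i) * w x := by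
  classical
  choose u hu huz hfu using fun i => exists_eq_pow_mul_entire (hf i) (hord i)
  choose v hv hvz hfv using fun i j => exists_iteratedDeriv_eq_zpow_mul (hu i) (hfu i) j
  -- The Wronskian matrix with the factors `(x - z)^(e i - l)` removed. At `z` its entries are `u i
  -- z` times falling factorials of the distinct integers `e i`, so it is invertible there.
  set A : ℂ → Matrix (Fin (N + 1)) (Fin (N + 1)) ℂ := fun x => Matrix.of fun i l => v i l x with hA
  have hent : ∀ i l, Differentiable ℂ fun x => A x i l := fun i l => hv i l
  have hrow : ∀ (a : Fin (N + 1) → ℂ) k, (A z).mulVec a k = 0 →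
      ∑ l, a l * ((e k).descFactorial l : ℂ) = 0 := by
    intro a k h0
    have h1 : (A z).mulVec a k = u k z * ∑ l, a l * ((e k).descFactorial l : ℂ) := by
      simp only [Matrix.mulVec, dotProduct, hA, Matrix.of_apply, hvz, Finset.mul_sum]
      exact Finset.sum_congr rfl fun l _ => by ring
    rw [h1] at h0
    exact (mul_eq_zero.1 h0).resolve_left (huz k)
  have hdetz : (A z).det ≠ 0 := by
    intro h0
    obtain ⟨a, ha, haA⟩ := Matrix.exists_mulVec_eq_zero_iff.2 h0
    refine ha (eq_zero_of_sum_descFactorial_eq_zero (Finset.univ.image e) ?_ fun j hj => ?_)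
    · intro s hs
      obtain ⟨k, -, rfl⟩ := Finset.mem_image.1 hs
      exact hrow a k (congrFun haA k)
    · rw [Finset.card_image_of_injective _ he, Finset.card_univ, Fintype.card_fin] at hj
      exact absurd j.2 (by omega)
  have hdetx : ∀ x ≠ z, (wronskianMatrix f x).det ≠ 0 → (A x).det ≠ 0 := by
    intro x hx hdet h0
    have hxz : x - z ≠ 0 := sub_ne_zero.2 hx
    obtain ⟨a, ha, haA⟩ := Matrix.exists_mulVec_eq_zero_iff.2 h0
    refine hdet (Matrix.exists_mulVec_eq_zero_iff.1
      ⟨fun l => (x - z) ^ (l : ℕ) * a l, fun h => ha ?_, ?_⟩)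
    · funext l
      exact (mul_eq_zero.1 (congrFun h l)).resolve_left (pow_ne_zero _ hxz)
    · funext k
      have h1 : (wronskianMatrix f x).mulVec (fun l => (x - z) ^ (l : ℕ) * a l) k =
          (x - z) ^ (e k) * (A x).mulVec a k := by
        simp only [Matrix.mulVec, dotProduct, hA, wronskianMatrix, Matrix.of_apply, Finset.mul_sum]
        refine Finset.sum_congr rfl fun l _ => ?_
        rw [hfv k l x hx, zpow_sub₀ hxz, zpow_natCast, zpow_natCast]
        field_simp
      rw [h1, haA]; simp
  refine ⟨fun x => (A x)⁻¹ (Fin.last N) i, fun h0 => ?_,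
    differentiableAt_inv_apply hent hdetz _ _, fun x hx hdet =>
    ⟨differentiableAt_inv_apply hent (hdetx x hx hdet) _ _, ?_⟩⟩
  · have hu' := isUnit_iff_ne_zero.2 hdetz
    set a : Fin (N + 1) → ℂ := fun l => (A z)⁻¹ l i with ha
    have haA : ∀ k, (A z).mulVec a k = if k = i then 1 else 0 := by
      intro k
      have := congrFun (congrFun (Matrix.mul_nonsing_inv (A z) hu') k) i
      rwa [Matrix.mul_apply, Matrix.one_apply] at this
    -- If the last entry of column `i` of the inverse were zero, the column would define a
    -- polynomial of degree below `N` vanishing at the `N` values `e k`, `k ≠ i`.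
    have ha0 : a = 0 := by
      refine eq_zero_of_sum_descFactorial_eq_zero ((Finset.univ.erase i).image e) ?_
        fun j hj => ?_
      · intro s hs
        obtain ⟨k, hk, rfl⟩ := Finset.mem_image.1 hs
        exact hrow a k (by rw [haA, if_neg (Finset.ne_of_mem_erase hk)])
      · rw [Finset.card_image_of_injective _ he, Finset.card_erase_of_mem (Finset.mem_univ i),
          Finset.card_univ, Fintype.card_fin] at hj
        rw [show j = Fin.last N from Fin.ext (by have := j.2; rw [Fin.val_last]; omega)]
        exact h0
    have := haA i
    rw [ha0] at this
    simp at this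
  · have hxz : x - z ≠ 0 := sub_ne_zero.2 hx
    have hu' := isUnit_iff_ne_zero.2 (hdetx x hx hdet)
    have hvec : Matrix.vecMul (fun k => (x - z) ^ ((N : ℤ) - e k) * (A x)⁻¹ (Fin.last N) k)
        (wronskianMatrix f x) = Pi.single (Fin.last N) 1 := by
      funext l
      have h1 : Matrix.vecMul (fun k => (x - z) ^ ((N : ℤ) - e k) * (A x)⁻¹ (Fin.last N) k)
          (wronskianMatrix f x) l = (x - z) ^ ((N : ℤ) - l) *
            ((A x)⁻¹ * A x) (Fin.last N) l := by
        simp only [Matrix.vecMul, dotProduct, Matrix.mul_apply, Finset.mul_sum]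
        refine Finset.sum_congr rfl fun k _ => ?_
        have h2 : wronskianMatrix f x k l = (x - z) ^ ((e k : ℤ) - l) * A x k l := hfv k l x hx
        rw [h2, show (N : ℤ) - l = (N - e k) + (e k - l) by ring, zpow_add₀ hxz]
        ring
      rw [h1, Matrix.nonsing_inv_mul _ hu', Matrix.one_apply]
      by_cases hl : l = Fin.last N
      · subst hl; simp
      · rw [if_neg (Ne.symm hl), Pi.single_eq_of_ne hl, mul_zero]
    have := eq_inv_apply_of_vecMul_eq_single hdet hvec i
    rw [conjugateFunction, this, one_mul]

end LocalForm

/-! ### Laplace transforms along circles -/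

/-- The function `u ↦ ∮ exp (u x) G(x) dx`, the integral being over the circle of radius `R`
around `z`. -/
def circleLaplace (z : ℂ) (R : ℝ) (G : ℂ → ℂ) (u : ℂ) : ℂ :=
  ∮ x in C(z, R), Complex.exp (u * x) * G x

section Laplace

variable {z : ℂ} {R : ℝ} {G : ℂ → ℂ}

theorem continuousOn_exp_mul (hG : ContinuousOn G (Metric.sphere z R)) (u : ℂ) :
    ContinuousOn (fun x => Complex.exp (u * x) * G x) (Metric.sphere z R) :=
  (by fun_prop : Continuous fun x => Complex.exp (u * x)).continuousOn.mul hG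

theorem hasDerivAt_circleLaplace (hR : 0 ≤ R) (hG : ContinuousOn G (Metric.sphere z R)) (u : ℂ) :
    HasDerivAt (circleLaplace z R G) (circleLaplace z R (fun x => x * G x) u) u := by
  have hmap := continuous_circleMap z R
  have hGc : Continuous fun θ : ℝ => G (circleMap z R θ) :=
    hG.comp_continuous hmap fun θ => circleMap_mem_sphere z hR θ
  have hder : Continuous fun θ : ℝ => deriv (circleMap z R) θ := by
    simp only [deriv_circleMap]; fun_prop
  have hF : ∀ v : ℂ, Continuous fun θ : ℝ => deriv (circleMap z R) θ •
      (Complex.exp (v * circleMap z R θ) * G (circleMap z R θ)) := fun v =>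
    hder.smul ((by fun_prop : Continuous fun θ => Complex.exp (v * circleMap z R θ)).mul hGc)
  have hF' : ∀ v : ℂ, Continuous fun θ : ℝ => deriv (circleMap z R) θ •
      (Complex.exp (v * circleMap z R θ) * (circleMap z R θ * G (circleMap z R θ))) := fun v =>
    hder.smul ((by fun_prop : Continuous fun θ => Complex.exp (v * circleMap z R θ)).mul
      (hmap.mul hGc))
  refine (intervalIntegral.hasDerivAt_integral_of_dominated_loc_of_deriv_le
    (s := Metric.ball u 1)
    (bound := fun θ => ‖deriv (circleMap z R) θ‖ * (Real.exp ((‖u‖ + 1) * ‖circleMap z R θ‖) *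
      ‖circleMap z R θ * G (circleMap z R θ)‖))
    (F' := fun v θ => deriv (circleMap z R) θ •
      (Complex.exp (v * circleMap z R θ) * (circleMap z R θ * G (circleMap z R θ))))
    (Metric.ball_mem_nhds u one_pos) (Eventually.of_forall fun v => (hF v).aestronglyMeasurable)
    ((hF u).intervalIntegrable _ _) (hF' u).aestronglyMeasurable ?_ ?_ ?_).2
  · refine Eventually.of_forall fun θ _ v hv => ?_
    rw [norm_smul, norm_mul]
    gcongr
    refine (Complex.norm_exp_le_exp_norm _).trans (Real.exp_le_exp.2 ?_)
    rw [norm_mul]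
    gcongr
    have h1 : ‖v - u‖ < 1 := by simpa [dist_eq_norm] using hv
    have h2 : ‖v‖ ≤ ‖u‖ + ‖v - u‖ := by simpa using norm_add_le u (v - u)
    linarith
  · refine Continuous.intervalIntegrable ?_ _ _
    exact hder.norm.mul ((by fun_prop : Continuous fun θ =>
      Real.exp ((‖u‖ + 1) * ‖circleMap z R θ‖)).mul (hmap.mul hGc).norm)
  · refine Eventually.of_forall fun θ _ v _ => ?_
    have h1 : HasDerivAt (fun v : ℂ => Complex.exp (v * circleMap z R θ))
        (Complex.exp (v * circleMap z R θ) * (1 * circleMap z R θ)) v :=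
      ((hasDerivAt_id v).mul_const _).cexp
    have h2 : HasDerivAt (fun v : ℂ => deriv (circleMap z R) θ •
        (Complex.exp (v * circleMap z R θ) * G (circleMap z R θ))) _ v :=
      (h1.mul_const (G (circleMap z R θ))).const_smul (deriv (circleMap z R) θ)
    rw [one_mul, mul_assoc] at h2
    exact h2

theorem continuousOn_pow_mul (hG : ContinuousOn G (Metric.sphere z R)) (k : ℕ) :
    ContinuousOn (fun x => x ^ k * G x) (Metric.sphere z R) :=
  (continuous_pow k).continuousOn.mul hG

theorem iteratedDeriv_circleLaplace (hR : 0 ≤ R) (hG : ContinuousOn G (Metric.sphere z R))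
    (k : ℕ) : iteratedDeriv k (circleLaplace z R G) = circleLaplace z R fun x => x ^ k * G x := by
  induction k with
  | zero => simp
  | succ k ih =>
    funext u
    rw [iteratedDeriv_succ, ih,
      (hasDerivAt_circleLaplace hR (continuousOn_pow_mul hG k) u).deriv]
    simp only [pow_succ', mul_assoc]

/-- Both sides are the symbol `∑ A i j x^i u^j`, grouped by powers of `x` or of `u`. -/
theorem sum_eval_dualCoeff_mul_pow {N M : ℕ} {c : Fin (N + 1) → ℂ[X]}
    (hM : ∀ i, M < i → dualCoeff c i = 0) (u x : ℂ) :
    ∑ k : Fin (M + 1), (dualCoeff c k).eval u * x ^ (k : ℕ) =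
      ∑ j : Fin (N + 1), (c j).eval x * u ^ (j : ℕ) := by
  have hdeg : ∀ j, (c j).natDegree < M + 1 := by
    intro j
    refine Nat.lt_succ_of_le (Polynomial.natDegree_le_iff_coeff_eq_zero.2 fun i hi => ?_)
    rw [← coeff_dualCoeff, hM i hi, Polynomial.coeff_zero]
  simp only [dualCoeff, Polynomial.eval_finsetSum, Polynomial.eval_monomial, Finset.sum_mul]
  rw [Finset.sum_comm]
  refine Finset.sum_congr rfl fun j _ => ?_
  rw [Polynomial.eval_eq_sum_range' (hdeg j), Finset.sum_range, Finset.sum_mul]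
  exact Finset.sum_congr rfl fun k _ => by ring

/-- The operator `∑ c j ∂ ^ j`, applied under the integral sign. -/
theorem sum_dualCoeff_mul_iteratedDeriv_circleLaplace {N M : ℕ} {c : Fin (N + 1) → ℂ[X]}
    (hM : ∀ i, M < i → dualCoeff c i = 0) (hR : 0 ≤ R)
    (hG : ContinuousOn G (Metric.sphere z R)) (u : ℂ) :
    ∑ k : Fin (M + 1), (dualCoeff c k).eval u * iteratedDeriv (k : ℕ) (circleLaplace z R G) u =
      ∮ x in C(z, R), (∑ j : Fin (N + 1), (c j).eval x *
        iteratedDeriv (j : ℕ) (fun x => Complex.exp (u * x)) x) * G x := by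
  have h1 : ∀ k : Fin (M + 1), (dualCoeff c k).eval u *
      iteratedDeriv (k : ℕ) (circleLaplace z R G) u = ∮ x in C(z, R), (dualCoeff c k).eval u *
        (Complex.exp (u * x) * (x ^ (k : ℕ) * G x)) := by
    intro k
    rw [circleIntegral.integral_const_mul, iteratedDeriv_circleLaplace hR hG]
    rfl
  -- On `exp(ux)`, `∂_x` multiplies by `u` and `∂_u` by `x`, so the two operators act through the
  -- same symbol.
  rw [Finset.sum_congr rfl fun k _ => h1 k, ← circleIntegral.integral_fun_sum]
  · refine circleIntegral.integral_congr hR fun x _ => ?_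
    have h2 : ∀ j : ℕ, iteratedDeriv j (fun x => Complex.exp (u * x)) x =
        u ^ j * Complex.exp (u * x) := by
      intro j
      rw [iteratedDeriv_cexp_const_mul]
    simp only [h2, ← mul_assoc, ← Finset.sum_mul]
    rw [← sum_eval_dualCoeff_mul_pow hM]
    simp only [Finset.sum_mul]
    exact Finset.sum_congr rfl fun k _ => by ring
  · intro k _
    refine ContinuousOn.circleIntegrable hR (ContinuousOn.mul continuousOn_const ?_)
    exact continuousOn_exp_mul (continuousOn_pow_mul hG k) u

theorem circleLaplace_pow_mul_eq_zero (hR : 0 < R) {ψ : ℂ → ℂ}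
    (hψ : ∀ x ∈ Metric.closedBall z R, DifferentiableAt ℂ ψ x) (k : ℕ) (u : ℂ) :
    circleLaplace z R (fun x => (x - z) ^ (k : ℤ) * ψ x) u = 0 := by
  have hd : ∀ x ∈ Metric.closedBall z R, DifferentiableAt ℂ
      (fun x => Complex.exp (u * x) * ((x - z) ^ (k : ℤ) * ψ x)) x := by
    intro x hx
    have := hψ x hx
    simp only [zpow_natCast]
    fun_prop
  refine Complex.circleIntegral_eq_zero_of_differentiable_on_off_countable hR.le
    Set.countable_empty (fun x hx => (hd x hx).continuousAt.continuousWithinAt) fun x hx => ?_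
  exact hd x (Metric.ball_subset_closedBall hx.1)

/-- The Laplace transform of a function with a pole of order `d + 1` at `z`. -/
theorem exists_circleLaplace_eq_quasiPolynomial (hR : 0 < R) {ψ : ℂ → ℂ}
    (hψ : ∀ x ∈ Metric.closedBall z R, DifferentiableAt ℂ ψ x) (hψz : ψ z ≠ 0) (d : ℕ) :
    ∃ q : ℂ[X], q.natDegree = d ∧
      circleLaplace z R (fun x => (x - z) ^ (-(d + 1 : ℤ)) * ψ x) = quasiPolynomial q z := by
  have hψa : AnalyticAt ℂ ψ z := by
    have hon : DifferentiableOn ℂ ψ (Metric.ball z R) := fun x hx =>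
      (hψ x (Metric.ball_subset_closedBall hx)).differentiableWithinAt
    exact hon.analyticAt (Metric.ball_mem_nhds z hR)
  set κ : ℂ := 2 * Real.pi * Complex.I / d.factorial with hκ
  have hκ0 : κ ≠ 0 := div_ne_zero Complex.two_pi_I_ne_zero (by exact_mod_cast d.factorial_ne_zero)
  -- Cauchy's formula gives the `d`-th derivative of `exp(ux) ψ` at `z`, and Leibniz's rule gives
  -- these coefficients; the top one is `κ * ψ z ≠ 0`.
  set q : ℂ[X] := ∑ i ∈ Finset.range (d + 1),
    Polynomial.monomial i (κ * ((d.choose i : ℂ) * iteratedDeriv (d - i) ψ z)) with hq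
  refine ⟨q, ?_, ?_⟩
  · refine Polynomial.natDegree_eq_of_le_of_coeff_ne_zero ?_ (?_ : q.coeff d ≠ 0)
    · refine Polynomial.natDegree_sum_le_of_forall_le _ _ fun i hi => ?_
      exact (Polynomial.natDegree_monomial_le _).trans (Nat.le_of_lt_succ (Finset.mem_range.1 hi))
    · rw [hq, Polynomial.finsetSum_coeff, Finset.sum_eq_single d]
      · simp [hκ0, hψz]
      · intro i _ hi
        rw [Polynomial.coeff_monomial, if_neg hi]
      · simp
  · funext u
    have hon : DifferentiableOn ℂ (fun x => Complex.exp (u * x) * ψ x) (Metric.closedBall z R) := by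
      intro x hx
      have := hψ x hx
      exact DifferentiableAt.differentiableWithinAt (by fun_prop)
    have h1 := hon.circleIntegral_one_div_sub_center_pow_smul hR d
    have h2 : circleLaplace z R (fun x => (x - z) ^ (-(d + 1 : ℤ)) * ψ x) u =
        ∮ x in C(z, R), (1 / (x - z) ^ (d + 1)) • (Complex.exp (u * x) * ψ x) := by
      refine circleIntegral.integral_congr hR.le fun x _ => ?_
      dsimp only
      rw [zpow_neg, smul_eq_mul, one_div]
      norm_cast
      ring
    rw [h2, h1, ← hκ]
    have h3 : iteratedDeriv d (fun x => Complex.exp (u * x) * ψ x) z =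
        ∑ i ∈ Finset.range (d + 1), (d.choose i : ℂ) * iteratedDeriv i (fun x => Complex.exp (u * x)) z *
          iteratedDeriv (d - i) ψ z :=
      iteratedDeriv_mul (by fun_prop) hψa.contDiffAt
    rw [h3, quasiPolynomial, hq, Polynomial.eval_finsetSum, smul_eq_mul, Finset.mul_sum,
      Finset.sum_mul]
    refine Finset.sum_congr rfl fun i _ => ?_
    rw [iteratedDeriv_cexp_const_mul, Polynomial.eval_monomial, mul_comm z u]
    ring

end Laplace

/-! ### Laplace transforms of the regularized conjugate space -/

section Dual

variable {N : ℕ} {W : Submodule ℂ (ℂ → ℂ)} {c : Fin (N + 1 + 1) → ℂ[X]}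

/-- The functions `g i / R` with `g i` the conjugate functions of a basis. -/
def regularizedConjugateFunction (b : Module.Basis (Fin (N + 1)) ℂ W) (i : Fin (N + 1)) (x : ℂ) :
    ℂ :=
  conjugateFunction (fun i => (b i : ℂ → ℂ)) i x * (regularizingFactor W x)⁻¹

namespace IsPrimitiveOperator

theorem continuousAt_regularizedConjugateFunction (h : IsPrimitiveOperator (N + 1) W c)
    (b : Module.Basis (Fin (N + 1)) ℂ W) (i : Fin (N + 1)) {x : ℂ} (hx : x ∉ singularPoints W) :
    ContinuousAt (regularizedConjugateFunction b i) x := by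
  have hdet := det_wronskianMatrix_ne_zero h.entire b hx
  refine ContinuousAt.mul (differentiableAt_inv_apply (differentiable_wronskianMatrix_apply
    fun i => h.entire (b i).2) hdet _ _).continuousAt (ContinuousAt.inv₀ ?_ ?_)
  · rw [funext h.regularizingFactor_eq]
    exact (Polynomial.continuous _).continuousAt
  · rw [h.regularizingFactor_eq]
    exact (h.singular x).not.1 hx

theorem continuousOn_regularizedConjugateFunction (h : IsPrimitiveOperator (N + 1) W c)
    (b : Module.Basis (Fin (N + 1)) ℂ W) (i : Fin (N + 1)) {z : ℂ} {R : ℝ}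
    (hsph : ∀ x ∈ Metric.sphere z R, x ∉ singularPoints W) :
    ContinuousOn (regularizedConjugateFunction b i) (Metric.sphere z R) := fun x hx =>
  (h.continuousAt_regularizedConjugateFunction b i (hsph x hx)).continuousWithinAt

/-- The dual operator annihilates the Laplace transforms of the regularized conjugate space. -/
theorem annihilates_circleLaplace (h : IsPrimitiveOperator (N + 1) W c) {M : ℕ}
    (hM : ∀ i, M < i → dualCoeff c i = 0) (b : Module.Basis (Fin (N + 1)) ℂ W) (i : Fin (N + 1))
    {z : ℂ} {R : ℝ} (hR : 0 ≤ R) (hsph : ∀ x ∈ Metric.sphere z R, x ∉ singularPoints W) :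
    Annihilates (fun k : Fin (M + 1) => dualCoeff c k)
      (circleLaplace z R (regularizedConjugateFunction b i)) := by
  intro u
  rw [sum_dualCoeff_mul_iteratedDeriv_circleLaplace hM hR
    (h.continuousOn_regularizedConjugateFunction b i hsph)]
  -- The integrand is the derivative of a single-valued function along the circle.
  obtain ⟨H, hH⟩ := exists_hasDerivAt_variation (f := fun i => (b i : ℂ → ℂ))
    (fun i => h.entire (b i).2) (fun i => h.annihilates _ (b i).2)
    (h := fun x => Complex.exp (u * x)) (by fun_prop) i
  refine circleIntegral.integral_eq_zero_of_hasDerivWithinAt (f := H) hR fun x hx => ?_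
  have h1 := hH x (det_wronskianMatrix_ne_zero h.entire b (hsph x hx))
    ((h.singular x).not.1 (hsph x hx))
  rw [regularizedConjugateFunction, h.regularizingFactor_eq]
  convert h1.hasDerivWithinAt using 1
  ring

/-- The conjugate function contributes `N - e i`, and division by the leading coefficient subtracts
its multiplicity. As the dimension is `N + 1`, a pole occurs exactly when `e i` plus the
multiplicity reaches `N + 1`. -/
theorem exists_regularizedConjugateFunction_eq (h : IsPrimitiveOperator (N + 1) W c)
    (b : Module.Basis (Fin (N + 1)) ℂ W) {z : ℂ} {e : Fin (N + 1) → ℕ} (he : Function.Injective e)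
    (hord : ∀ i, meromorphicOrderAt (b i : ℂ → ℂ) z = ((e i : ℤ) : WithTop ℤ))
    {R : ℝ} (hR : 0 < R) (hball : ∀ x ∈ Metric.closedBall z R, x ≠ z → x ∉ singularPoints W)
    (i : Fin (N + 1)) :
    ∃ ψ : ℂ → ℂ, ψ z ≠ 0 ∧ (∀ x ∈ Metric.closedBall z R, DifferentiableAt ℂ ψ x) ∧
      ∀ x ∈ Metric.sphere z R, regularizedConjugateFunction b i x =
        (x - z) ^ ((N : ℤ) - e i - (c (Fin.last (N + 1))).rootMultiplicity z) * ψ x := by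
  obtain ⟨w, hwz, hwd, hw⟩ := exists_conjugateFunction_eq_zpow_mul
    (f := fun i => (b i : ℂ → ℂ)) (fun i => h.entire (b i).2) he hord i
  obtain ⟨q, hq, hqz⟩ := Polynomial.exists_eq_pow_rootMultiplicity_mul_and_not_dvd
    (c (Fin.last (N + 1))) h.monic.ne_zero z
  set μ := (c (Fin.last (N + 1))).rootMultiplicity z with hμ
  rw [Polynomial.dvd_iff_isRoot, Polynomial.IsRoot] at hqz
  have hc : ∀ x, (c (Fin.last (N + 1))).eval x = (x - z) ^ μ * q.eval x := by
    intro x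
    conv_lhs => rw [hq]
    simp
  have hqx : ∀ x ∈ Metric.closedBall z R, x ≠ z → q.eval x ≠ 0 := by
    intro x hx hxz h0
    exact (h.singular x).not.1 (hball x hx hxz) (by rw [hc, h0, mul_zero])
  refine ⟨fun x => w x / q.eval x, div_ne_zero hwz hqz, fun x hx => ?_, fun x hx => ?_⟩
  · rcases eq_or_ne x z with rfl | hxz
    · exact hwd.div q.differentiable.differentiableAt hqz
    · exact (hw x hxz (det_wronskianMatrix_ne_zero h.entire b (hball x hx hxz))).1.div
        q.differentiable.differentiableAt (hqx x hx hxz)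
  · have hxz : x ≠ z := by
      rintro rfl
      simp [hR.ne] at hx
    have hx' := Metric.sphere_subset_closedBall hx
    have h1 : x - z ≠ 0 := sub_ne_zero.2 hxz
    rw [regularizedConjugateFunction, h.regularizingFactor_eq, hc,
      (hw x hxz (det_wronskianMatrix_ne_zero h.entire b (hball x hx' hxz))).2,
      zpow_sub₀ h1 _ (μ : ℤ), zpow_natCast]
    have := hqx x hx' hxz
    field_simp

theorem circleLaplace_eq_zero (h : IsPrimitiveOperator (N + 1) W c)
    (b : Module.Basis (Fin (N + 1)) ℂ W) {z : ℂ} {e : Fin (N + 1) → ℕ} (he : Function.Injective e)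
    (hord : ∀ i, meromorphicOrderAt (b i : ℂ → ℂ) z = ((e i : ℤ) : WithTop ℤ))
    {R : ℝ} (hR : 0 < R) (hball : ∀ x ∈ Metric.closedBall z R, x ≠ z → x ∉ singularPoints W)
    {i : Fin (N + 1)} (hi : e i + (c (Fin.last (N + 1))).rootMultiplicity z < N + 1) :
    circleLaplace z R (regularizedConjugateFunction b i) = 0 := by
  obtain ⟨ψ, -, hψd, hψ⟩ := h.exists_regularizedConjugateFunction_eq b he hord hR hball i
  obtain ⟨k, hk⟩ : ∃ k : ℕ, (N : ℤ) - e i - (c (Fin.last (N + 1))).rootMultiplicity z = k :=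
    Int.eq_ofNat_of_zero_le (by omega)
  rw [hk] at hψ
  funext u
  rw [Pi.zero_apply, ← circleLaplace_pow_mul_eq_zero hR hψd k u]
  exact circleIntegral.integral_congr hR.le fun x hx => by simp only [hψ x hx]

theorem exists_circleLaplace_eq (h : IsPrimitiveOperator (N + 1) W c)
    (b : Module.Basis (Fin (N + 1)) ℂ W) {z : ℂ} {e : Fin (N + 1) → ℕ} (he : Function.Injective e)
    (hord : ∀ i, meromorphicOrderAt (b i : ℂ → ℂ) z = ((e i : ℤ) : WithTop ℤ))
    {R : ℝ} (hR : 0 < R) (hball : ∀ x ∈ Metric.closedBall z R, x ≠ z → x ∉ singularPoints W)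
    {i : Fin (N + 1)} {d : ℕ}
    (hi : e i + (c (Fin.last (N + 1))).rootMultiplicity z = N + 1 + d) :
    ∃ q : ℂ[X], q.natDegree = d ∧
      circleLaplace z R (regularizedConjugateFunction b i) = quasiPolynomial q z := by
  obtain ⟨ψ, hψz, hψd, hψ⟩ := h.exists_regularizedConjugateFunction_eq b he hord hR hball i
  rw [show (N : ℤ) - e i - (c (Fin.last (N + 1))).rootMultiplicity z = -(d + 1 : ℤ) by
    omega] at hψ
  obtain ⟨q, hq, hq'⟩ := exists_circleLaplace_eq_quasiPolynomial hR hψd hψz d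
  refine ⟨q, hq, ?_⟩
  rw [← hq']
  funext u
  exact circleIntegral.integral_congr hR.le fun x hx => by simp only [hψ x hx]

end IsPrimitiveOperator

end Dual

/-! ### The bispectral dual as a space of quasi-polynomials -/

section BispectralDual

variable {N : ℕ} {W : Submodule ℂ (ℂ → ℂ)} {m : ℕ} {z : Fin m → ℂ} {Ma : Fin m → ℕ}
  {e : ∀ a, Fin (Ma a) → ℕ} {r : ℂ → ℝ} {M : ℕ}

/-- At `z a`, basis elements of order below `N + 1 - Ma a` have zero transform, and that of order `N
+ 1 - Ma a + e a b` yields a polynomial of degree `e a b` times the exponential. -/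
theorem IsPrimitiveOperator.exists_bispectralDual_eq {c : Fin (N + 1 + 1) → ℂ[X]}
    (h : IsPrimitiveOperator (N + 1) W c) (hsing : Set.range z = singularPoints W)
    (hexp : ∀ a, exponents W (z a) = shiftedExponents (N + 1) (Ma a) (e a))
    (hmult : ∀ a, (c (Fin.last (N + 1))).rootMultiplicity (z a) = Ma a) (hr : SmallCircles W r)
    (hM : ∀ i, M < i → dualCoeff c i = 0) :
    ∃ q : ∀ a, Fin (Ma a) → ℂ[X], (∀ a b, (q a b).natDegree = e a b) ∧
      bispectralDual W r = quasiPolynomialSpace q z ∧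
      ∀ f ∈ quasiPolynomialSpace q z, Annihilates (fun k : Fin (M + 1) => dualCoeff c k) f := by
  have := h.finite
  have hza : ∀ a, z a ∈ singularPoints W := fun a => hsing ▸ ⟨a, rfl⟩
  have hR : ∀ a, 0 < r (z a) := fun a => (hr _ (hza a)).1
  have hball : ∀ a, ∀ x ∈ Metric.closedBall (z a) (r (z a)), x ≠ z a → x ∉ singularPoints W :=
    fun a x hx hxz hxs => (hr _ (hza a)).2 x hxs hxz hx
  have hsph : ∀ a, ∀ x ∈ Metric.sphere (z a) (r (z a)), x ∉ singularPoints W := by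
    intro a x hx
    refine hball a x (Metric.sphere_subset_closedBall hx) ?_
    rintro rfl
    simp [(hR a).ne] at hx
  -- Each singular point gets its own adapted basis; the regularized conjugate space is spanned by
  -- the functions of any one of them.
  choose β ε hε hord hrange using fun a => exists_adapted_basis h.entire h.dim (z a)
  have hidx : ∀ a b, ∃ i, ε a i + Ma a = N + 1 + e a b := by
    intro a b
    have h1 : ((N + 1 : ℕ) : ℤ) - Ma a + e a b ∈ exponents W (z a) := by
      rw [hexp]; exact Or.inr ⟨b, rfl⟩
    rw [hrange] at h1
    obtain ⟨i, hi⟩ := h1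
    exact ⟨i, by dsimp only at hi; omega⟩
  choose idx hidx using hidx
  have hq : ∀ a b, ∃ q : ℂ[X], q.natDegree = e a b ∧ circleLaplace (z a) (r (z a))
      (regularizedConjugateFunction (β a) (idx a b)) = quasiPolynomial q (z a) := fun a b =>
    h.exists_circleLaplace_eq (β a) (hε a) (hord a) (hR a) (hball a)
      (by rw [hmult]; exact hidx a b)
  choose q hqdeg hq using hq
  refine ⟨q, hqdeg, le_antisymm ?_ ?_, fun f hf => (annihilates_of_mem_span ?_ hf).2⟩
  · refine Submodule.span_le.2 ?_
    rintro g ⟨z₀, hz₀, f, hf, rfl⟩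
    obtain ⟨a, rfl⟩ : z₀ ∈ Set.range z := hsing ▸ hz₀
    rw [regularizedConjugateSpace_eq_span h.entire (β a)] at hf
    obtain ⟨t, rfl⟩ := (Submodule.mem_span_range_iff_exists_fun ℂ).1 hf
    have h1 : (fun u => ∮ x in C(z a, r (z a)), Complex.exp (u * x) * (∑ i, t i • fun x =>
        conjugateFunction (fun i => (β a i : ℂ → ℂ)) i x * (regularizingFactor W x)⁻¹) x) =
        ∑ i, t i • circleLaplace (z a) (r (z a)) (regularizedConjugateFunction (β a) i) := by
      funext u
      rw [Finset.sum_apply]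
      simp only [Pi.smul_apply, circleLaplace, smul_eq_mul, ← circleIntegral.integral_const_mul]
      rw [← circleIntegral.integral_fun_sum]
      · refine circleIntegral.integral_congr (hR a).le fun x _ => ?_
        simp only [Finset.sum_apply, Pi.smul_apply, smul_eq_mul, Finset.mul_sum,
          regularizedConjugateFunction]
        exact Finset.sum_congr rfl fun i _ => by ring
      · intro i _
        refine ContinuousOn.circleIntegrable (hR a).le (continuousOn_const.mul ?_)
        exact continuousOn_exp_mul
          (h.continuousOn_regularizedConjugateFunction (β a) i (hsph a)) u
    rw [SetLike.mem_coe, h1]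
    refine Submodule.sum_mem _ fun i _ => Submodule.smul_mem _ _ ?_
    have h2 : (ε a i : ℤ) ∈ exponents W (z a) := by rw [hrange]; exact ⟨i, rfl⟩
    rw [hexp] at h2
    rcases h2 with h2 | ⟨b, hb⟩
    · rw [h.circleLaplace_eq_zero (β a) (hε a) (hord a) (hR a) (hball a)
        (by rw [hmult]; have := h2.2; omega)]
      exact Submodule.zero_mem _
    · have h3 : i = idx a b := hε a (by have := hidx a b; dsimp only at hb; omega)
      rw [h3, hq]
      exact quasiPolynomial_mem a b
  · refine Submodule.span_le.2 ?_
    rintro g ⟨a, b, rfl⟩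
    refine Submodule.subset_span ⟨z a, hza a, regularizedConjugateFunction (β a) (idx a b), ?_, ?_⟩
    · rw [regularizedConjugateSpace_eq_span h.entire (β a)]
      exact Submodule.subset_span ⟨idx a b, rfl⟩
    · exact (hq a b).symm
  · rintro g ⟨a, b, rfl⟩
    refine ⟨differentiable_quasiPolynomial (q a b) (z a), ?_⟩
    have h1 := h.annihilates_circleLaplace hM (β a) (idx a b) (hR a).le (hsph a)
    rw [hq] at h1
    exact h1

end BispectralDual

/-! ### Singular points and exponents of the dual -/

section DualExponents

variable {N M : ℕ}
  {c : Fin (N + 1) → ℂ[X]} {U : Submodule ℂ (ℂ → ℂ)}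

theorem exponents_subset_natCast {W : Submodule ℂ (ℂ → ℂ)} (hW : W ≤ entireFunctions) {z : ℂ}
    {k : ℤ} (hk : k ∈ exponents W z) : ∃ s : ℕ, k = s := by
  obtain ⟨f, hf, hfk⟩ := hk
  exact natCast_of_meromorphicOrderAt_eq (hW hf) hfk

/-- A set of `dim W` natural numbers which contains the exponents is the set of exponents. -/
theorem mem_exponents_iff_of_forall_mem {W : Submodule ℂ (ℂ → ℂ)} (hW : W ≤ entireFunctions)
    [FiniteDimensional ℂ W] {z : ℂ} {T : Finset ℕ} (hT : T.card ≤ Module.finrank ℂ W)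
    (h : ∀ s : ℕ, (s : ℤ) ∈ exponents W z → s ∈ T) (s : ℕ) :
    (s : ℤ) ∈ exponents W z ↔ s ∈ T := by
  obtain ⟨S, hS, hSe⟩ := exists_exponents_finset hW rfl z
  rw [← hSe, Finset.eq_of_subset_of_card_le (fun s hs => h s ((hSe s).1 hs)) (hT.trans_eq hS.symm)]

/-- In the lowest degree `-M` only `∂^M` contributes. The indicial polynomial is a nonzero multiple
of the falling factorial of length `M`, whose natural roots are `0, …, M - 1`. -/
theorem exponents_eq_of_eval_dualCoeff_ne_zero (hU : U ≤ entireFunctions) [FiniteDimensional ℂ U]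
    (hdim : Module.finrank ℂ U = M)
    (hcU : ∀ f ∈ U, Annihilates (fun k : Fin (M + 1) => dualCoeff c k) f) {u : ℂ}
    (hu : (dualCoeff c M).eval u ≠ 0) :
    exponents U u = Set.Ico (0 : ℤ) (Module.finrank ℂ U) := by
  have hsub : ∀ s : ℕ, (s : ℤ) ∈ exponents U u → s ∈ Finset.range M := by
    intro s hs
    have h1 := sum_indicialCoeff_of_mem_exponents (h := -(M : ℤ)) hU hcU
      (fun j i hij => absurd j.2 (by omega)) hs
    rw [Finset.sum_eq_single (Fin.last M)] at h1
    · rw [indicialCoeff, if_pos (by simp), Fin.val_last] at h1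
      simp only [neg_add_cancel, Int.toNat_zero, Polynomial.taylor_coeff_zero] at h1
      have h2 := (mul_eq_zero.1 h1).resolve_left hu
      rw [Nat.cast_eq_zero, Nat.descFactorial_eq_zero_iff_lt] at h2
      exact Finset.mem_range.2 h2
    · intro j _ hj
      have := Fin.val_lt_last hj
      rw [indicialCoeff, if_neg (by omega), zero_mul]
    · simp
  have hiff := mem_exponents_iff_of_forall_mem hU (by simp [hdim]) hsub
  ext k
  constructor
  · intro hk
    obtain ⟨s, rfl⟩ := exponents_subset_natCast hU hk
    have := Finset.mem_range.1 (hsub s hk)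
    rw [hdim]
    exact ⟨by omega, by omega⟩
  · rintro ⟨h0, h1⟩
    obtain ⟨s, rfl⟩ := Int.eq_ofNat_of_zero_le h0
    rw [hdim] at h1
    exact (hiff s).2 (Finset.mem_range.2 (by omega))

/-- By `sum_indicialCoeff_dual`, the indicial polynomial at `mu` has natural roots only in `T`. This
set has at most `M` elements, and there are `M` exponents. -/
theorem exponents_dual_eq (hU : U ≤ entireFunctions) [FiniteDimensional ℂ U]
    (hdim : Module.finrank ℂ U = M)
    (hcU : ∀ f ∈ U, Annihilates (fun k : Fin (M + 1) => dualCoeff c k) f)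
    (hM : ∀ i, M < i → dualCoeff c i = 0) {mu : ℂ} {k : ℕ} {d : Fin k → ℕ}
    (hd : Function.Injective d)
    (hS : ∀ s ∈ Finset.univ.image d, ∃ q : ℂ[X], q ≠ 0 ∧ q.natDegree = s ∧
      Annihilates c (quasiPolynomial q mu)) (hkM : k ≤ M)
    (hroot : ∀ s : ℕ, ∑ j, indicialCoeffInfty mu c ((M : ℤ) - k) j * (s.descFactorial j : ℂ) = 0 →
      s ∈ Finset.univ.image d) :
    exponents U mu = shiftedExponents M k d := by
  classical
  have hcard : (Finset.univ.image d).card = k := by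
    rw [Finset.card_image_of_injective _ hd, Finset.card_univ, Fintype.card_fin]
  set T : Finset ℕ := Finset.range (M - k) ∪ Finset.univ.image (fun j => M - k + d j) with hT
  have hTcard : T.card ≤ Module.finrank ℂ U := by
    refine (Finset.card_union_le _ _).trans ?_
    rw [Finset.card_range, hdim]
    have := Finset.card_image_le (s := Finset.univ) (f := fun j => M - k + d j)
    simp only [Finset.card_univ, Fintype.card_fin] at this
    omega
  have hsub : ∀ s : ℕ, (s : ℤ) ∈ exponents U mu → s ∈ T := by
    intro s hs
    -- Transposition reverses the sign of the degree, so the vanishing of high degrees of `c` at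
    -- infinity becomes the vanishing of low degrees of the dual at `mu`.
    have h1 := sum_indicialCoeff_of_mem_exponents (h := -((M - k : ℕ) : ℤ)) hU hcU
      (fun j i hij => coeff_taylor_dualCoeff_eq_zero hM hS (by rw [hcard]; omega)) hs
    rw [sum_indicialCoeff_dual hM] at h1
    rcases mul_eq_zero.1 h1 with h2 | h2
    · rw [Nat.cast_eq_zero, Nat.descFactorial_eq_zero_iff_lt] at h2
      exact Finset.mem_union_left _ (Finset.mem_range.2 h2)
    · rcases lt_or_ge s (M - k) with h3 | h3
      · exact Finset.mem_union_left _ (Finset.mem_range.2 h3)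
      · rw [show ((M - k : ℕ) : ℤ) = (M : ℤ) - k by omega] at h2
        obtain ⟨j, -, hj⟩ := Finset.mem_image.1 (hroot _ h2)
        exact Finset.mem_union_right _ (Finset.mem_image.2 ⟨j, Finset.mem_univ j, by omega⟩)
  have hiff := mem_exponents_iff_of_forall_mem hU hTcard hsub
  ext t
  constructor
  · intro ht
    obtain ⟨s, rfl⟩ := exponents_subset_natCast hU ht
    rcases Finset.mem_union.1 (hsub s ht) with h1 | h1
    · have := Finset.mem_range.1 h1
      exact Or.inl ⟨by omega, by omega⟩
    · obtain ⟨j, -, hj⟩ := Finset.mem_image.1 h1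
      exact Or.inr ⟨j, by dsimp only at hj ⊢; omega⟩
  · rintro (⟨h0, h1⟩ | ⟨j, rfl⟩)
    · obtain ⟨s, rfl⟩ := Int.eq_ofNat_of_zero_le h0
      exact (hiff s).2 (Finset.mem_union_left _ (Finset.mem_range.2 (by omega)))
    · have h1 := (hiff (M - k + d j)).2
        (Finset.mem_union_right _ (Finset.mem_image.2 ⟨j, Finset.mem_univ j, rfl⟩))
      dsimp only
      rwa [show (M : ℤ) - k + d j = ((M - k + d j : ℕ) : ℤ) by omega]

/-- The integer `M - k` is skipped, since every `d j` is positive. -/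
theorem shiftedExponents_ne_Ico {M k : ℕ} (hk : 0 < k) (hkM : k ≤ M) {d : Fin k → ℕ}
    (hd : ∀ j, 0 < d j) : shiftedExponents M k d ≠ Set.Ico (0 : ℤ) M := by
  intro h
  have h1 : (M : ℤ) - k ∈ shiftedExponents M k d := by
    rw [h]; exact ⟨by omega, by omega⟩
  rcases h1 with h1 | ⟨j, hj⟩
  · exact absurd h1.2 (by omega)
  · have := hd j
    dsimp only at hj
    omega

end DualExponents

/-! ### Polynomial operators given by matrices of coefficients -/

theorem sum_coeff_mul_pow_eq_eval {M : ℕ} {q : ℂ[X]} (hq : q.natDegree < M + 1) (x : ℂ) :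
    ∑ i : Fin (M + 1), q.coeff i * x ^ (i : ℕ) = q.eval x := by
  rw [Polynomial.eval_eq_sum_range' hq, Finset.sum_range]

theorem eval_dualCoeff {N : ℕ} (c : Fin (N + 1) → ℂ[X]) (i : ℕ) (u : ℂ) :
    (dualCoeff c i).eval u = ∑ j : Fin (N + 1), (c j).coeff i * u ^ (j : ℕ) := by
  simp [dualCoeff, Polynomial.eval_finsetSum]

theorem natDegree_eq_sum_rootMultiplicity {m : ℕ} {z : Fin m → ℂ} (hz : Function.Injective z)
    {q : ℂ[X]} (hq : q ≠ 0) (hroots : ∀ x, q.eval x = 0 ↔ x ∈ Set.range z) :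
    q.natDegree = ∑ a, q.rootMultiplicity (z a) := by
  classical
  rw [← IsAlgClosed.card_roots_eq_natDegree (p := q), ← Multiset.toFinset_sum_count_eq]
  have h1 : q.roots.toFinset = Finset.univ.image z := by
    ext x
    rw [Multiset.mem_toFinset, Polynomial.mem_roots hq, Polynomial.IsRoot, hroots]
    simp
  rw [h1, Finset.sum_image fun a _ b _ hab => hz hab]
  simp

/-- The bispectral dual of a space of quasi-polynomials is a space of quasi-polynomials annihilated
by the dual operator. -/
theorem exists_bispectralDual_eq_quasiPolynomialSpace {N m M : ℕ} {W : Submodule ℂ (ℂ → ℂ)}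
    {z : Fin m → ℂ} {Ma : Fin m → ℕ} {e : ∀ a, Fin (Ma a) → ℕ} {r : ℂ → ℝ}
    {c : Fin (N + 1) → ℂ[X]} (h : IsPrimitiveOperator N W c)
    (hsing : Set.range z = singularPoints W) (hMa : ∀ a, 1 ≤ Ma a ∧ Ma a ≤ N)
    (hexp : ∀ a, exponents W (z a) = shiftedExponents N (Ma a) (e a))
    (hmult : ∀ a, (c (Fin.last N)).rootMultiplicity (z a) = Ma a) (hr : SmallCircles W r)
    (hM : ∀ i, M < i → dualCoeff c i = 0) :
    ∃ q : ∀ a, Fin (Ma a) → ℂ[X], (∀ a b, (q a b).natDegree = e a b) ∧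
      bispectralDual W r = quasiPolynomialSpace q z ∧
      ∀ f ∈ quasiPolynomialSpace q z, Annihilates (fun k : Fin (M + 1) => dualCoeff c k) f := by
  -- In dimension zero the bounds on `Ma` exclude singular points, and both spaces are zero.
  obtain _ | N := N
  · have hno : IsEmpty (Fin m) := ⟨fun a => by have := hMa a; omega⟩
    have hempty : singularPoints W = ∅ := by rw [← hsing, Set.range_eq_empty]
    have hbot : ∀ q : ∀ a, Fin (Ma a) → ℂ[X], quasiPolynomialSpace q z = ⊥ := by
      intro q
      refine Submodule.span_eq_bot.2 ?_
      rintro g ⟨a, -⟩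
      exact hno.elim a
    refine ⟨fun a => hno.elim a, fun a => hno.elim a, ?_, fun f hf => ?_⟩
    · rw [hbot]
      refine Submodule.span_eq_bot.2 ?_
      rintro g ⟨w, hw, -⟩
      rw [hempty] at hw
      exact hw.elim
    · rw [hbot, Submodule.mem_bot] at hf
      intro x
      simp [hf, iteratedDeriv_const_zero]
  · exact h.exists_bispectralDual_eq hsing hexp hmult hr hM

end

/-! ### ### The bispectral duality theorem -/

theorem theorem2p5
    -- the space `V` of quasi-polynomials
    (n : ℕ) (Ni : Fin n → ℕ) (hNi : ∀ i, 0 < Ni i)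
    (deg : ∀ i, Fin (Ni i) → ℕ) (hdeg_pos : ∀ i j, 0 < deg i j)
    (hdeg_mono : ∀ i, StrictMono (deg i))
    (p : ∀ i, Fin (Ni i) → Polynomial ℂ) (hp : ∀ i j, (p i j).natDegree = deg i j)
    (lam : Fin n → ℂ) (hlam : Function.Injective lam)
    (N : ℕ) (hN : N = ∑ i, Ni i)
    (V : Submodule ℂ (ℂ → ℂ)) (hV : V = quasiPolynomialSpace p lam)
    -- its singular points and its exponents there
    (m : ℕ) (z : Fin m → ℂ) (hz : Function.Injective z) (hsing : Set.range z = singularPoints V)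
    (Ma : Fin m → ℕ) (hMa : ∀ a, 1 ≤ Ma a ∧ Ma a ≤ N)
    (e : ∀ a, Fin (Ma a) → ℕ) (he_pos : ∀ a b, 0 < e a b) (he_mono : ∀ a, StrictMono (e a))
    (hexp : ∀ a, exponents V (z a) = shiftedExponents N (Ma a) (e a))
    (M : ℕ) (hM : M = ∑ a, Ma a)
    -- small circles around the singular points, and the bispectral dual
    (r : ℂ → ℝ) (hr : SmallCircles V r)
    (U : Submodule ℂ (ℂ → ℂ)) (hU : U = bispectralDual V r) :
    -- (i)
    (FiniteDimensional ℂ U ∧ Module.finrank ℂ U = M) ∧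
    -- (ii)
    (∀ a b, ∃ q : Polynomial ℂ, q.natDegree = e a b ∧
      (fun u : ℂ => q.eval u * Complex.exp (z a * u)) ∈ U) ∧
    -- (iii)
    ((∃ A : Fin (M + 1) → Fin (N + 1) → ℂ,
        IsRegularizedFundamentalOperator N V fun j x => ∑ i, A i j * x ^ (i : ℕ)) ∧
      ∀ A : Fin (M + 1) → Fin (N + 1) → ℂ,
        (IsRegularizedFundamentalOperator N V fun j x => ∑ i, A i j * x ^ (i : ℕ)) →
        IsRegularizedFundamentalOperator M U fun i u => ∑ j, A i j * u ^ (j : ℕ)) ∧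
    -- (iv)
    singularPoints U = Set.range lam ∧
    -- (v)
    (∀ i, exponents U (lam i) = shiftedExponents M (Ni i) (deg i)) := by
  obtain rfl : deg = fun i j => (p i j).natDegree := by funext i j; exact (hp i j).symm
  have hp0 : ∀ i j, p i j ≠ 0 := fun i j h => by
    have := hdeg_pos i j
    simp [h] at this
  have hinj : ∀ i, Function.Injective fun j => (p i j).natDegree := fun i => (hdeg_mono i).injective
  have hVe : V ≤ entireFunctions := hV ▸ quasiPolynomialSpace_le_entireFunctions
  have hVfin : FiniteDimensional ℂ V := by rw [hV]; infer_instance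
  have hVdim : Module.finrank ℂ V = N := by
    rw [hV, hN]; exact finrank_quasiPolynomialSpace hp0 hinj hlam
  -- the primitive operator of `V`
  obtain ⟨c, hcmonic, hcV, hcprim⟩ := exists_primitive_operator hVe hVdim
    (hV ▸ exists_annihilates_quasiPolynomialSpace hN p lam)
  have hmult : ∀ a, (c (Fin.last N)).rootMultiplicity (z a) = Ma a := by
    intro a
    refine rootMultiplicity_last_eq hVe hVdim hcV (hcprim _) (hMa a).2 (fun s hs => ?_) fun h => ?_
    · rw [hexp]; exact Or.inl ⟨by omega, by omega⟩
    · rw [hexp] at h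
      have := (hMa a).2
      rcases h with h | ⟨b, hb⟩
      · exact absurd h.2 (by omega)
      · have := he_pos a b
        dsimp only at hb
        omega
  have hprim : IsPrimitiveOperator N V c := by
    refine ⟨hVe, hVdim, hVfin, hcmonic, hcV, hcprim, fun w => ⟨fun hw => ?_, fun hw => ?_⟩⟩
    · obtain ⟨a, rfl⟩ : w ∈ Set.range z := hsing ▸ hw
      have h1 := (hMa a).1
      rw [← hmult a] at h1
      exact ((Polynomial.rootMultiplicity_pos hcmonic.ne_zero).1 h1)
    -- At a nonsingular point the exponents are `0, …, N - 1`; the case `k = 0` of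
    -- `rootMultiplicity_last_eq` shows that the leading coefficient is nonzero there.
    · by_contra hns
      have hexpw : exponents V w = Set.Ico (0 : ℤ) N := by
        by_contra h; exact hns (by rw [← hVdim] at h; exact h)
      have h1 : (c (Fin.last N)).rootMultiplicity w = 0 := by
        refine rootMultiplicity_last_eq hVe hVdim hcV (hcprim _) (Nat.zero_le N)
          (fun s hs => ?_) ?_
        · rw [hexpw]; exact ⟨by omega, by omega⟩
        · rw [hexpw]; exact fun h => absurd h.2 (by omega)
      exact absurd ((Polynomial.rootMultiplicity_pos hcmonic.ne_zero).2 hw) (by omega)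
  have hMdeg : (c (Fin.last N)).natDegree = M := by
    rw [natDegree_eq_sum_rootMultiplicity hz hcmonic.ne_zero fun x => by
      rw [← hprim.singular, hsing], hM]
    exact Finset.sum_congr rfl fun a _ => hmult a
  obtain ⟨htop, hprod⟩ := dualCoeff_natDegree_last hN hp0 hinj hlam hcmonic (hV ▸ hcV)
  rw [hMdeg] at htop hprod
  -- the dual space
  obtain ⟨q, hqdeg, hUq, hcU⟩ := exists_bispectralDual_eq_quasiPolynomialSpace hprim hsing hMa
    hexp hmult hr htop
  rw [← hU] at hUq
  rw [← hUq] at hcU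
  have hq0 : ∀ a b, q a b ≠ 0 := fun a b h => by
    have := he_pos a b
    rw [← hqdeg, h] at this
    simp at this
  have hUe : U ≤ entireFunctions := hUq ▸ quasiPolynomialSpace_le_entireFunctions
  have hUfin : FiniteDimensional ℂ U := by rw [hUq]; infer_instance
  have hUdim : Module.finrank ℂ U = M := by
    rw [hUq, hM]
    refine finrank_quasiPolynomialSpace hq0 (fun a => ?_) hz
    simp only [hqdeg]
    exact (he_mono a).injective
  -- the exponents of the dual space
  have hS : ∀ i, ∀ s ∈ degreeFinset p i, ∃ q : ℂ[X], q ≠ 0 ∧ q.natDegree = s ∧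
      Annihilates c (quasiPolynomial q (lam i)) :=
    exists_of_mem_degreeFinset hp0 (hV ▸ hcV)
  have hdual : ∀ i, Ni i ≤ M ∧ (dualCoeff c (M - Ni i)).eval (lam i) ≠ 0 ∧
      ∀ s : ℕ, ∑ j, indicialCoeffInfty (lam i) c ((M : ℤ) - Ni i) j * (s.descFactorial j : ℂ) = 0 →
        s ∈ degreeFinset p i := by
    intro i
    have h1 := card_le_and_eval_dualCoeff_ne_zero htop (hS i) (fun h => ?_) ?_
    · rwa [card_degreeFinset (hinj i)] at h1
    · obtain ⟨j, -, hj⟩ := Finset.mem_image.1 h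
      exact absurd hj (hdeg_pos i j).ne'
    · rw [card_degreeFinset (hinj i), hprod]
      exact coeff_taylor_prod_ne_zero hlam i
  have hUexp : ∀ i, exponents U (lam i) =
      shiftedExponents M (Ni i) fun j => (p i j).natDegree := fun i =>
    exponents_dual_eq hUe hUdim hcU htop (hinj i) (hS i) (hdual i).1 (hdual i).2.2
  have htopne : ∀ u, (dualCoeff c M).eval u = 0 ↔ u ∈ Set.range lam := by
    intro u
    rw [hprod, Polynomial.eval_prod, Finset.prod_eq_zero_iff]
    constructor
    · rintro ⟨i, -, hi⟩
      refine ⟨i, ?_⟩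
      simp only [Polynomial.eval_pow, Polynomial.eval_sub, Polynomial.eval_X,
        Polynomial.eval_C] at hi
      exact (sub_eq_zero.1 (eq_zero_of_pow_eq_zero hi)).symm
    · rintro ⟨i, rfl⟩
      exact ⟨i, Finset.mem_univ i, by simp [(hNi i).ne']⟩
  have hUsing : singularPoints U = Set.range lam := by
    ext u
    constructor
    · intro hu
      by_contra hnot
      exact hu (exponents_eq_of_eval_dualCoeff_ne_zero hUe hUdim hcU ((htopne u).not.2 hnot))
    · rintro ⟨i, rfl⟩ h
      rw [hUexp, hUdim] at h
      exact shiftedExponents_ne_Ico (hNi i) (hdual i).1 (hdeg_pos i) h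
  have hprimU : IsPrimitiveOperator M U fun k : Fin (M + 1) => dualCoeff c k := by
    refine ⟨hUe, hUdim, hUfin, ?_, hcU, fun u => ?_, fun u => ?_⟩
    · rw [Fin.val_last, hprod]
      exact Polynomial.monic_prod_of_monic _ _ fun i _ => (Polynomial.monic_X_sub_C _).pow _
    -- The leading coefficient vanishes only at the `lam i`, where the coefficient of `∂^(M - Ni i)`
    -- does not.
    · by_cases hu : (dualCoeff c M).eval u = 0
      · obtain ⟨i, rfl⟩ := (htopne u).1 hu
        exact ⟨⟨M - Ni i, by omega⟩, (hdual i).2.1⟩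
      · exact ⟨Fin.last M, hu⟩
    · rw [hUsing, Fin.val_last, htopne]
  have hdeg : ∀ j, (c j).natDegree < M + 1 := fun j =>
    Nat.lt_succ_of_le (Polynomial.natDegree_le_iff_coeff_eq_zero.2 fun i hi => by
      rw [← coeff_dualCoeff, htop i hi, Polynomial.coeff_zero])
  refine ⟨⟨hUfin, hUdim⟩, fun a b => ⟨q a b, hqdeg a b, hUq ▸ quasiPolynomial_mem a b⟩,
    ⟨⟨fun i j => (c j).coeff i, ?_⟩, fun A hA => ?_⟩, hUsing, hUexp⟩
  · simp only [sum_coeff_mul_pow_eq_eval (hdeg _)]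
    exact hprim.isRegularizedFundamentalOperator
  -- An arbitrary admissible matrix is turned into polynomials, which uniqueness identifies with
  -- `c`.
  · set d : Fin (N + 1) → ℂ[X] := fun j => ∑ i : Fin (M + 1), Polynomial.monomial (i : ℕ) (A i j)
      with hd
    have hdc : d = c := by
      refine hprim.eq_of_isRegularizedFundamentalOperator ?_
      simpa [hd, Polynomial.eval_finsetSum] using hA
    have hAc : ∀ i j, A i j = (c j).coeff i := by
      intro i j
      rw [← hdc]
      simp [hd, Polynomial.coeff_monomial, Fin.val_inj]
    simp only [hAc, ← eval_dualCoeff]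
    exact hprimU.isRegularizedFundamentalOperator
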